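/- Let $R$ be an associative ring with unit; "module" means left $R$-module, and complexes are $\mathbb{Z}$-graded (unbounded) chain complexes $\cdots\to X_{n+1}\to X_n\to X_{n-1}\to\cdots$. A module $M$ is *Gorenstein flat* if there is an exact complex $T$ of flat modules such that $I\otimes_R T$ is exact for every injective right $R$-module $I$ and $M\cong\operatorname{Ker}(T_0\to T_{-1})$. The ring $R$ is *left GF-closed* if the class of Gorenstein flat left $R$-modules is closed under extensions. A complex $F$ of modules is *DG-flat* if every $F_n$ is flat and $E\otimes_R F$ is exact for every exact complex $E$ of right $R$-modules; here $(E\otimes_R F)_n=\bigoplus_t E_t\otimes_R F_{n-t}$ with the usual differential. Write $C_j(F)=\operatorname{Coker}(F_{j+1}\to F_j)$, and write $\sup H(X)\le g$ if $H_j(X)=0$ for all $j>g$. For a complex $N$ and $g\in\mathbb{Z}$: - $\operatorname{Gfd}N\le g$ means that there is a quasi-isomorphism $F\to N$ with $F$ DG-flat, $\sup H(F)\le g$, and $C_j(F)$ Gorenstein flat for all $j\ge g$; - $\operatorname{fd}N\le g$ means that $\sup H(N)\le g$ and that, for every DG-flat complex $F$ with $F\simeq N$ (where $\simeq$ is the equivalence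 relation generated by quasi-isomorphisms), $C_j(F)$ is flat for all $j\ge g$. The dimensions $\operatorname{Gfd}N$ and $\operatorname{fd}N$, with values in $\mathbb{Z}\cup\{-\infty,\infty\}$, are the infima of the integers $g$ for which the respective condition holds ($\infty$ if there is none, $-\infty$ if it holds for all $g$). **Proposition.** If $R$ is left GF-closed, then every complex $N$ of left $R$-modules satisfies $\operatorname{Gfd}N\le\operatorname{fd}N$, and $\operatorname{Gfd}N=\operatorname{fd}N$ whenever $\operatorname{fd}N<\infty$. -/

import Mathlib

open CategoryTheory CategoryTheory.Limits
open scoped TensorProduct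

universe u

namespace GorensteinFlat

/-! ### The tensor product over a noncommutative ring

`R` is an associative ring with unit. Left `R`-modules are the objects of `ModuleCat R`, right
`R`-modules those of `ModuleCat Rᵐᵒᵖ`, with `x · r = MulOpposite.op r • x`. -/

section Tensor

variable {R : Type u} [Ring R]

/-- The subgroup of `A ⊗_ℤ M` generated by the elements `(a · r) ⊗ m - a ⊗ (r m)`. -/
def balancedRel (A : ModuleCat.{u} Rᵐᵒᵖ) (M : ModuleCat.{u} R) : Submodule ℤ (A ⊗[ℤ] M) :=
  Submodule.span ℤ
    {z | ∃ (a : A) (r : R) (m : M),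
      z = (MulOpposite.op r • a) ⊗ₜ[ℤ] m - a ⊗ₜ[ℤ] (r • m)}

/-- The abelian group `A ⊗_R M`, for a right module `A` and a left module `M`. -/
abbrev TensorObj (A : ModuleCat.{u} Rᵐᵒᵖ) (M : ModuleCat.{u} R) : Type u :=
  (A ⊗[ℤ] M) ⧸ balancedRel A M

/-- The map `f ⊗ g : A ⊗_R M → B ⊗_R N` induced by `f : A → B` and `g : M → N`. -/
def tensorMap {A B : ModuleCat.{u} Rᵐᵒᵖ} {M N : ModuleCat.{u} R} (f : A ⟶ B) (g : M ⟶ N) :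
    TensorObj A M →ₗ[ℤ] TensorObj B N :=
  Submodule.mapQ _ _
    (TensorProduct.map f.hom.toAddMonoidHom.toIntLinearMap g.hom.toAddMonoidHom.toIntLinearMap)
    (by
      rw [balancedRel, Submodule.span_le]
      rintro _ ⟨a, r, m, rfl⟩
      refine Submodule.subset_span ⟨f.hom a, r, g.hom m, ?_⟩
      exact (map_sub _ _ _).trans <| congrArg₂ (· - ·)
        (congrArg (· ⊗ₜ[ℤ] g.hom m) (f.hom.map_smul (MulOpposite.op r) a))
        (congrArg (f.hom a ⊗ₜ[ℤ] ·) (g.hom.map_smul r m)))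

lemma tensorMap_mk_tmul {A B : ModuleCat.{u} Rᵐᵒᵖ} {M N : ModuleCat.{u} R}
    (f : A ⟶ B) (g : M ⟶ N) (a : A) (m : M) :
    tensorMap f g (Submodule.Quotient.mk (a ⊗ₜ[ℤ] m)) =
      Submodule.Quotient.mk (f.hom a ⊗ₜ[ℤ] g.hom m) := rfl

lemma tensorObj_hom_ext {A : ModuleCat.{u} Rᵐᵒᵖ} {M : ModuleCat.{u} R} {P : Type*}
    [AddCommGroup P] {f g : TensorObj A M →ₗ[ℤ] P}
    (h : ∀ (a : A) (m : M), f (Submodule.Quotient.mk (a ⊗ₜ[ℤ] m)) =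
      g (Submodule.Quotient.mk (a ⊗ₜ[ℤ] m))) : f = g := by
  apply Submodule.linearMap_qext
  apply TensorProduct.ext'
  exact h

variable (R) in
/-- The bifunctor `(A, M) ↦ A ⊗_R M` from right and left `R`-modules to `ℤ`-modules. -/
def tensorBifunctor : ModuleCat.{u} Rᵐᵒᵖ ⥤ ModuleCat.{u} R ⥤ ModuleCat.{u} ℤ where
  obj A :=
    { obj := fun M => ModuleCat.of ℤ (TensorObj A M)
      map := fun g => ModuleCat.ofHom (tensorMap (𝟙 A) g)
      map_id := fun M => by
        apply ModuleCat.hom_ext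
        apply tensorObj_hom_ext
        intro a m
        rfl
      map_comp := fun g h => by
        apply ModuleCat.hom_ext
        apply tensorObj_hom_ext
        intro a m
        rfl }
  map f :=
    { app := fun M => ModuleCat.ofHom (tensorMap f (𝟙 M))
      naturality := fun M N g => by
        apply ModuleCat.hom_ext
        apply tensorObj_hom_ext
        intro a m
        rfl }
  map_id A := by
    ext M : 2
    apply ModuleCat.hom_ext
    apply tensorObj_hom_ext
    intro a m
    rfl
  map_comp f g := by
    ext M : 2
    apply ModuleCat.hom_ext
    apply tensorObj_hom_ext
    intro a m
    rfl

instance (A : ModuleCat.{u} Rᵐᵒᵖ) : ((tensorBifunctor R).obj A).Additive where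
  map_add {M N g h} := by
    apply ModuleCat.hom_ext
    apply tensorObj_hom_ext
    intro a m
    exact congrArg Submodule.Quotient.mk (TensorProduct.tmul_add a (g.hom m) (h.hom m))

instance : (tensorBifunctor R).Additive where
  map_add {A B f g} := by
    ext M : 2
    apply ModuleCat.hom_ext
    apply tensorObj_hom_ext
    intro a m
    exact congrArg Submodule.Quotient.mk (TensorProduct.add_tmul (f.hom a) (g.hom a) m)

end Tensor

/-- The signs `(-1)^t` in the differential of the tensor product of two complexes that are
graded homologically by `ℤ`. -/
instance tensorSignsDown : (ComplexShape.down ℤ).TensorSigns where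
  ε' := MonoidHom.mk' Int.negOnePow Int.negOnePow_add
  rel_add p q r (hpq : q + 1 = p) := by
    change _ + 1 = _
    lia
  add_rel p q r (hpq : q + 1 = p) := by
    change _ + 1 = _
    lia
  ε'_succ := by
    rintro _ q rfl
    exact (by rw [Int.negOnePow_succ, neg_neg] :
      Int.negOnePow q = - Int.negOnePow (q + 1))

section Modules

variable {R : Type u} [Ring R]

/-- The tensor product `X ⊗_R Y` of a complex of right modules and a complex of left modules:
`(X ⊗ Y)_n = ⨁_t X_t ⊗ Y_{n-t}` with the differential
`x ⊗ y ↦ δ x ⊗ y + (-1)^t x ⊗ δ y` for `x ∈ X_t`. -/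
noncomputable def tensorComplex (X : ChainComplex (ModuleCat.{u} Rᵐᵒᵖ) ℤ)
    (Y : ChainComplex (ModuleCat.{u} R) ℤ) : ChainComplex (ModuleCat.{u} ℤ) ℤ :=
  HomologicalComplex.mapBifunctor X Y (tensorBifunctor R) (ComplexShape.down ℤ)

/-- A left module `M` is flat if `- ⊗_R M` preserves injections of right modules. -/
def IsFlat (M : ModuleCat.{u} R) : Prop :=
  ∀ ⦃A B : ModuleCat.{u} Rᵐᵒᵖ⦄ (f : A ⟶ B), Function.Injective f.hom →
    Function.Injective (tensorMap f (𝟙 M))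

/-- The complex `I ⊗_R T`, for a right module `I` and a complex `T` of left modules. -/
noncomputable def moduleTensorComplex (I : ModuleCat.{u} Rᵐᵒᵖ)
    (T : ChainComplex (ModuleCat.{u} R) ℤ) : ChainComplex (ModuleCat.{u} ℤ) ℤ :=
  (((tensorBifunctor R).obj I).mapHomologicalComplex (ComplexShape.down ℤ)).obj T

/-- A left module `M` is Gorenstein flat if there is an exact complex `T` of flat modules such
that `I ⊗ T` is exact for every injective right module `I` and `M ≅ Ker (T_0 → T_{-1})`. -/
def IsGorensteinFlat (M : ModuleCat.{u} R) : Prop :=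
  ∃ T : ChainComplex (ModuleCat.{u} R) ℤ,
    T.Acyclic ∧ (∀ n, IsFlat (T.X n)) ∧
    (∀ I : ModuleCat.{u} Rᵐᵒᵖ, Injective I → (moduleTensorComplex I T).Acyclic) ∧
    Nonempty (M ≅ T.cycles 0)

variable (R) in
/-- `R` is left GF-closed if the class of Gorenstein flat left modules is closed under
extensions. -/
def IsLeftGFClosed : Prop :=
  ∀ S : ShortComplex (ModuleCat.{u} R), S.ShortExact →
    IsGorensteinFlat S.X₁ → IsGorensteinFlat S.X₃ → IsGorensteinFlat S.X₂

/-! ### DG-flat complexes and the two dimensions -/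

/-- A complex `F` of left modules is DG-flat if each `F_n` is flat and `E ⊗ F` is exact for
every exact complex `E` of right modules. -/
def IsDGFlat (F : ChainComplex (ModuleCat.{u} R) ℤ) : Prop :=
  (∀ n, IsFlat (F.X n)) ∧
    ∀ E : ChainComplex (ModuleCat.{u} Rᵐᵒᵖ) ℤ, E.Acyclic → (tensorComplex E F).Acyclic

/-- `sup H(N) ≤ g`: the homology of `N` vanishes in all degrees `j > g`. -/
def SupHomologyLE (N : ChainComplex (ModuleCat.{u} R) ℤ) (g : ℤ) : Prop :=
  ∀ j, g < j → N.ExactAt j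

/-- `Gfd N ≤ g`: there is a DG-flat resolution `F → N` (a quasi-isomorphism with `F` DG-flat)
such that `sup H(F) ≤ g` and `C_j(F) = Coker (F_{j+1} → F_j)` is Gorenstein flat for `j ≥ g`. -/
def GfdLE (N : ChainComplex (ModuleCat.{u} R) ℤ) (g : ℤ) : Prop :=
  ∃ (F : ChainComplex (ModuleCat.{u} R) ℤ) (π : F ⟶ N), IsDGFlat F ∧ QuasiIso π ∧
    SupHomologyLE F g ∧ ∀ j, g ≤ j → IsGorensteinFlat (F.opcycles j)

/-- The equivalence relation generated by quasi-isomorphisms. -/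
def QuasiIsomorphic (X Y : ChainComplex (ModuleCat.{u} R) ℤ) : Prop :=
  Relation.EqvGen (fun K L => ∃ f : K ⟶ L, QuasiIso f) X Y

/-- `fd N ≤ g`: `sup H(N) ≤ g` and for every DG-flat complex `F ≃ N` the module
`C_j(F) = Coker (F_{j+1} → F_j)` is flat for `j ≥ g`. -/
def FdLE (N : ChainComplex (ModuleCat.{u} R) ℤ) (g : ℤ) : Prop :=
  SupHomologyLE N g ∧ ∀ F : ChainComplex (ModuleCat.{u} R) ℤ, IsDGFlat F →
    QuasiIsomorphic F N → ∀ j, g ≤ j → IsFlat (F.opcycles j)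

/-- The infimum in `ℤ ∪ {-∞, ∞}` of the integers `g` with `P g`: it is `∞` if there is no such
`g`, and `-∞` if every `g` is one. -/
noncomputable def infDim (P : ℤ → Prop) : WithBot (WithTop ℤ) :=
  sInf {x | ∃ g : ℤ, P g ∧ x = ((g : WithTop ℤ) : WithBot (WithTop ℤ))}

/-- The Gorenstein flat dimension of a complex. -/
noncomputable def gfd (N : ChainComplex (ModuleCat.{u} R) ℤ) : WithBot (WithTop ℤ) :=
  infDim (GfdLE N)

/-- The (Avramov–Foxby) flat dimension of a complex. -/
noncomputable def fd (N : ChainComplex (ModuleCat.{u} R) ℤ) : WithBot (WithTop ℤ) :=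
  infDim (FdLE N)

end Modules

end GorensteinFlat

/-! Write `M⁺` for the character module `Hom_ℤ(M, ℚ/ℤ)`. The inequality holds because every complex
has a DG-flat resolution (`exists_isDGFlat_resolution`) and flat modules are Gorenstein flat
(`IsFlat.isGorensteinFlat`), so `fd N ≤ g` implies `Gfd N ≤ g`.

For the equality, let `F` be a DG-flat complex witnessing `Gfd N ≤ g`, and let `fd N ≤ g₀`. The
modules `C_j(F)` are Gorenstein flat for `j ≥ g` and flat for `j ≥ g₀`. Since `H_{j+1}(F) = 0`, the
sequence `0 → C_{j+1} → F_j → C_j → 0` is exact for `j ≥ g`. A Gorenstein flat quotient of a flat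
module by a flat submodule is flat, because the dual sequence splits
(`IsGorensteinFlat.isFlat_of_shortExact`). Hence flatness descends from `g₀` to `g`.

As `fd` refers to all DG-flat complexes `F' ≃ N`, flatness must also pass from `F` to `F'`
(`IsDGFlat.isFlat_opcycles`). The duals `F⁺` and `F'⁺` are K-injective
(`isKInjective_rightDualComplex`), hence homotopy equivalent. Moreover `C_i(F)` is flat iff `C_i(F)⁺
= Z^i(F⁺)` is injective, that is, iff the surjection from `(F⁺)^i` onto `Z^{i+1}(F⁺)` splits, and
this splitting is a homotopy invariant (`SplitsAt.of_homotopy`). -/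

namespace GorensteinFlat

/-! ### Character modules -/

section Dual

/-- The injective cogenerator `ℚ/ℤ` of the category of abelian groups. -/
abbrev QZ : Type u := ULift.{u} (AddCircle (1 : ℚ))

/-- `ℚ/ℤ` as an object of the category of `ℤ`-modules. -/
abbrev qz : ModuleCat.{u} ℤ := ModuleCat.of ℤ QZ.{u}

instance : Injective qz.{u} :=
  Module.injective_object_of_injective_module ℤ _ (inj :=
    ((Module.Baer.of_divisible (AddCircle (1 : ℚ))).of_equiv ULift.moduleEquiv.symm).injective)

/-- An additive map between `ℤ`-modules, as a morphism. -/
def intHom {A B : ModuleCat.{u} ℤ} (f : A →+ B) : A ⟶ B :=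
  ModuleCat.ofHom
    { f with map_smul' r a := by simpa using map_intCast_smul f ℤ ℤ r a }

lemma exists_character_ne_zero {A : ModuleCat.{u} ℤ} {a : A} (ha : a ≠ 0) :
    ∃ φ : A ⟶ qz.{u}, φ.hom a ≠ 0 := by
  obtain ⟨c, hc⟩ := CharacterModule.exists_character_apply_ne_zero_of_ne_zero
    (A := A.carrier) ha
  refine ⟨intHom (B := qz.{u}) (AddEquiv.ulift.symm.toAddMonoidHom.comp
    (AddMonoidHom.mk' c (map_add c))), fun h ↦ hc ?_⟩
  exact congrArg (fun x : QZ.{u} ↦ x.down) h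

/-- If `φ` kills the kernel of `g`, then it factors through `g`. -/
lemma exists_factor {V W : Type u} [AddCommGroup V] [AddCommGroup W] (g : V →+ W)
    (φ : V →+ QZ.{u}) (h : ∀ v, g v = 0 → φ v = 0) :
    ∃ ψ : W →+ QZ.{u}, ∀ v, ψ (g v) = φ v := by
  let j : ModuleCat.of ℤ (V ⧸ g.ker) ⟶ ModuleCat.of ℤ W :=
    ModuleCat.ofHom (QuotientAddGroup.kerLift g).toIntLinearMap
  have : Mono j := (ModuleCat.mono_iff_injective _).2 (QuotientAddGroup.kerLift_injective g)
  let φ' : ModuleCat.of ℤ (V ⧸ g.ker) ⟶ qz.{u} :=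
    ModuleCat.ofHom (QuotientAddGroup.lift g.ker φ (fun v hv ↦ h v hv)).toIntLinearMap
  refine ⟨(Injective.factorThru φ' j).hom.toAddMonoidHom, fun v ↦ ?_⟩
  exact congr($(Injective.comp_factorThru φ' j).hom (QuotientAddGroup.mk v))

/-- The character group `Hom_ℤ(M, ℚ/ℤ)`. -/
def Character (M : Type u) [AddCommGroup M] : Type u := M →+ QZ.{u}

namespace Character

section

variable (M : Type u) [AddCommGroup M]

instance : AddCommGroup (Character M) := inferInstanceAs (AddCommGroup (M →+ QZ.{u}))
instance : FunLike (Character M) M QZ.{u} := inferInstanceAs (FunLike (M →+ QZ.{u}) M QZ.{u})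
instance : AddMonoidHomClass (Character M) M QZ.{u} :=
  inferInstanceAs (AddMonoidHomClass (M →+ QZ.{u}) M QZ.{u})

variable {M}

@[ext] lemma ext {φ ψ : Character M} (h : ∀ m, φ m = ψ m) : φ = ψ := DFunLike.ext _ _ h

end

variable {R : Type u} [Ring R]

/-- The characters of a left module form a right module. -/
instance (M : Type u) [AddCommGroup M] [Module R M] : Module Rᵐᵒᵖ (Character M) where
  smul r φ := AddMonoidHom.comp (show M →+ QZ.{u} from φ)
    (DistribSMul.toAddMonoidHom M (MulOpposite.unop r))
  one_smul φ := ext fun m ↦ congrArg φ (one_smul R m)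
  mul_smul r s φ := ext fun m ↦ congrArg φ (mul_smul (MulOpposite.unop s) (MulOpposite.unop r) m)
  smul_zero _ := rfl
  smul_add _ _ _ := rfl
  add_smul r s φ := ext fun m ↦
    (congrArg φ (add_smul (MulOpposite.unop r) (MulOpposite.unop s) m)).trans (map_add φ _ _)
  zero_smul φ := ext fun m ↦ (congrArg φ (zero_smul R m)).trans (map_zero φ)

end Character

variable {R : Type u} [Ring R]

/-- The character group of a right module, viewed as a left module. -/
def LeftCharacter (A : Type u) [AddCommGroup A] : Type u := A →+ QZ.{u}

instance (A : Type u) [AddCommGroup A] : AddCommGroup (LeftCharacter A) :=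
  inferInstanceAs (AddCommGroup (A →+ QZ.{u}))

instance (A : Type u) [AddCommGroup A] [Module Rᵐᵒᵖ A] : Module R (LeftCharacter A) where
  smul r φ := AddMonoidHom.comp (show A →+ QZ.{u} from φ)
    (DistribSMul.toAddMonoidHom A (MulOpposite.op r))
  one_smul φ := AddMonoidHom.ext fun m ↦ congrArg (show A →+ QZ.{u} from φ) (one_smul Rᵐᵒᵖ m)
  mul_smul r s φ := AddMonoidHom.ext fun m ↦ congrArg (show A →+ QZ.{u} from φ)
    (mul_smul (MulOpposite.op s) (MulOpposite.op r) m)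
  smul_zero _ := rfl
  smul_add _ _ _ := rfl
  add_smul r s φ := AddMonoidHom.ext fun m ↦
    (congrArg (show A →+ QZ.{u} from φ) (add_smul (MulOpposite.op r) (MulOpposite.op s) m)).trans
      (map_add (show A →+ QZ.{u} from φ) _ _)
  zero_smul φ := AddMonoidHom.ext fun m ↦
    (congrArg (show A →+ QZ.{u} from φ) (zero_smul Rᵐᵒᵖ m)).trans
      (map_zero (show A →+ QZ.{u} from φ))

/-- The left module of characters of a right module. -/
def leftDual (A : ModuleCat.{u} Rᵐᵒᵖ) : ModuleCat.{u} R := ModuleCat.of R (LeftCharacter A)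

instance (A : ModuleCat.{u} Rᵐᵒᵖ) : FunLike (leftDual A) A QZ.{u} :=
  inferInstanceAs (FunLike (A →+ QZ.{u}) A QZ.{u})
instance (A : ModuleCat.{u} Rᵐᵒᵖ) : AddMonoidHomClass (leftDual A) A QZ.{u} :=
  inferInstanceAs (AddMonoidHomClass (A →+ QZ.{u}) A QZ.{u})

namespace leftDual

variable {A B : ModuleCat.{u} Rᵐᵒᵖ}

@[ext] lemma ext {φ ψ : leftDual A} (h : ∀ m : A, φ m = ψ m) : φ = ψ := DFunLike.ext _ _ h

/-- The map induced on left modules of characters. -/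
def map (f : A ⟶ B) : leftDual B ⟶ leftDual A := ModuleCat.ofHom
  { toFun φ := AddMonoidHom.comp (show B →+ QZ.{u} from φ) f.hom.toAddMonoidHom
    map_add' _ _ := rfl
    map_smul' r φ := ext fun a ↦
      congrArg (show B →+ QZ.{u} from φ) (map_smul f.hom (MulOpposite.op r) a).symm }

lemma map_zero : map (0 : A ⟶ B) = 0 :=
  ModuleCat.hom_ext (LinearMap.ext fun φ ↦ leftDual.ext fun _ ↦ _root_.map_zero φ)

lemma map_comp {C : ModuleCat.{u} Rᵐᵒᵖ} (f : A ⟶ B) (g : B ⟶ C) :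
    map (f ≫ g) = map g ≫ map f := rfl

end leftDual

/-- The right module of characters of a left module. -/
def rightDual (M : ModuleCat.{u} R) : ModuleCat.{u} Rᵐᵒᵖ := ModuleCat.of Rᵐᵒᵖ (Character M)

instance (M : ModuleCat.{u} R) : FunLike (rightDual M) M QZ.{u} :=
  inferInstanceAs (FunLike (M →+ QZ.{u}) M QZ.{u})
instance (M : ModuleCat.{u} R) : AddMonoidHomClass (rightDual M) M QZ.{u} :=
  inferInstanceAs (AddMonoidHomClass (M →+ QZ.{u}) M QZ.{u})

namespace rightDual

variable {M N : ModuleCat.{u} R}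

@[ext] lemma ext {φ ψ : rightDual M} (h : ∀ m : M, φ m = ψ m) : φ = ψ := DFunLike.ext _ _ h

/-- The map induced on right modules of characters. -/
def map (f : M ⟶ N) : rightDual N ⟶ rightDual M := ModuleCat.ofHom
  { toFun φ := AddMonoidHom.comp (show N →+ QZ.{u} from φ) f.hom.toAddMonoidHom
    map_add' _ _ := rfl
    map_smul' r φ := ext fun m ↦ congrArg φ (map_smul f.hom (MulOpposite.unop r) m).symm }

end rightDual

variable (R) in
/-- The exact contravariant functor sending a left module to its right module of characters. -/
def rightDualFunctor : (ModuleCat.{u} R)ᵒᵖ ⥤ ModuleCat.{u} Rᵐᵒᵖ where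
  obj M := rightDual M.unop
  map f := rightDual.map f.unop

instance : (rightDualFunctor R).Additive where
  map_add {M N f g} := by
    refine ModuleCat.hom_ext (LinearMap.ext fun φ ↦ rightDual.ext fun m ↦ ?_)
    exact map_add (show rightDual M.unop from φ) (f.unop.hom m) (g.unop.hom m)

/-- Injectivity of `ℚ/ℤ`: a character that vanishes on the kernel of a map factors through the map.
-/
instance : (rightDualFunctor R).PreservesHomology := by
  apply Functor.preservesHomology_of_map_exact
  intro S hS
  rw [ShortComplex.moduleCat_exact_iff]
  intro φ hφ
  have hS' := (ShortComplex.moduleCat_exact_iff _).1 hS.unop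
  obtain ⟨ψ, hψ⟩ := exists_factor S.f.unop.hom.toAddMonoidHom
    (show S.X₂.unop →+ QZ.{u} from φ) (by
      intro v hv
      obtain ⟨w, rfl⟩ := hS' v hv
      exact DFunLike.congr_fun (show (_ : rightDual S.X₃.unop) = 0 from hφ) w)
  exact ⟨ψ, rightDual.ext hψ⟩

/-! ### Characters of a tensor product -/

section Tensor

variable {A B : ModuleCat.{u} Rᵐᵒᵖ} {M N : ModuleCat.{u} R}

/-- The universal property of `A ⊗_R M` for maps to `ℚ/ℤ`. -/
def tensorDesc (b : A →+ M →+ QZ.{u})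
    (hb : ∀ a (r : R) m, b (MulOpposite.op r • a) m = b a (r • m)) :
    ((tensorBifunctor R).obj A).obj M ⟶ qz.{u} :=
  ModuleCat.ofHom (Submodule.liftQ (balancedRel A M)
    (TensorProduct.liftAddHom b (fun z a m ↦ by
      rw [map_zsmul, map_zsmul, AddMonoidHom.zsmul_apply])).toIntLinearMap (by
      rw [balancedRel, Submodule.span_le]
      rintro _ ⟨a, r, m, rfl⟩
      exact (map_sub _ _ _).trans (sub_eq_zero.2 (hb a r m))))

/-- The element `a ⊗ m` of `A ⊗_R M`. -/
def tmul (a : A) (m : M) : ((tensorBifunctor R).obj A).obj M :=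
  Submodule.Quotient.mk (a ⊗ₜ[ℤ] m)

lemma tensor_hom_ext {P : ModuleCat.{u} ℤ} {f g : ((tensorBifunctor R).obj A).obj M ⟶ P}
    (h : ∀ a m, f.hom (tmul a m) = g.hom (tmul a m)) : f = g :=
  ModuleCat.hom_ext (Submodule.linearMap_qext _ (TensorProduct.ext' h))

lemma add_tmul (a a' : A) (m : M) : tmul (a + a') m = tmul a m + tmul a' m :=
  congrArg Submodule.Quotient.mk (TensorProduct.add_tmul a a' m)

lemma tmul_add (a : A) (m m' : M) : tmul a (m + m') = tmul a m + tmul a m' :=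
  congrArg Submodule.Quotient.mk (TensorProduct.tmul_add a m m')

lemma op_smul_tmul (r : R) (a : A) (m : M) :
    tmul (MulOpposite.op r • a) m = tmul a (r • m) :=
  (Submodule.Quotient.eq _).2 (Submodule.subset_span ⟨a, r, m, rfl⟩)

/-- The character of `A ⊗_R M` defined by a map from `A` to the characters of `M`. -/
def uncurryRight (f : A ⟶ rightDual M) : ((tensorBifunctor R).obj A).obj M ⟶ qz.{u} :=
  tensorDesc (show A →+ M →+ QZ.{u} from f.hom.toAddMonoidHom)
    (fun a r m ↦ DFunLike.congr_fun (f.hom.map_smul (MulOpposite.op r) a) m)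

/-- The map from `A` to the characters of `M` defined by a character of `A ⊗_R M`. -/
def curryRight (φ : ((tensorBifunctor R).obj A).obj M ⟶ qz.{u}) : A ⟶ rightDual M :=
  ModuleCat.ofHom
    { toFun a := (AddMonoidHom.mk' (fun m ↦ φ.hom (tmul a m))
        (fun m m' ↦ by rw [tmul_add, map_add]) : M →+ QZ.{u})
      map_add' a a' := rightDual.ext fun m ↦
        (congrArg φ.hom (add_tmul a a' m)).trans (map_add _ _ _)
      map_smul' r a := rightDual.ext fun m ↦ congrArg φ.hom (op_smul_tmul r.unop a m) }

/-- The character of `A ⊗_R M` defined by a map from `M` to the characters of `A`. -/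
def uncurryLeft (f : M ⟶ leftDual A) : ((tensorBifunctor R).obj A).obj M ⟶ qz.{u} :=
  tensorDesc (AddMonoidHom.flip (show M →+ A →+ QZ.{u} from f.hom.toAddMonoidHom))
    (fun a r m ↦ (DFunLike.congr_fun (f.hom.map_smul r m) a).symm)

/-- The map from `M` to the characters of `A` defined by a character of `A ⊗_R M`. -/
def curryLeft (φ : ((tensorBifunctor R).obj A).obj M ⟶ qz.{u}) : M ⟶ leftDual A :=
  ModuleCat.ofHom
    { toFun m := (AddMonoidHom.mk' (fun a ↦ φ.hom (tmul a m))
        (fun a a' ↦ by rw [add_tmul, map_add]) : A →+ QZ.{u})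
      map_add' m m' := leftDual.ext fun a ↦
        (congrArg φ.hom (tmul_add a m m')).trans (map_add _ _ _)
      map_smul' r m := leftDual.ext fun a ↦ (congrArg φ.hom (op_smul_tmul r a m)).symm }

/-- Characters of `A ⊗_R M` are maps from `A` to the characters of `M`. -/
def curryRightEquiv : (((tensorBifunctor R).obj A).obj M ⟶ qz.{u}) ≃+ (A ⟶ rightDual M) where
  toFun := curryRight
  invFun := uncurryRight
  left_inv _ := tensor_hom_ext fun _ _ ↦ rfl
  right_inv _ := rfl
  map_add' _ _ := rfl

lemma curryRightEquiv_map_app_comp (f : A ⟶ B)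
    (φ : ((tensorBifunctor R).obj B).obj M ⟶ qz.{u}) :
    curryRightEquiv (((tensorBifunctor R).map f).app M ≫ φ) = f ≫ curryRightEquiv φ := rfl

lemma curryRightEquiv_obj_map_comp (g : M ⟶ N)
    (φ : ((tensorBifunctor R).obj A).obj N ⟶ qz.{u}) :
    curryRightEquiv (((tensorBifunctor R).obj A).map g ≫ φ) =
      curryRightEquiv φ ≫ rightDual.map g := rfl

/-- Characters of `A ⊗_R M` are maps from `M` to the characters of `A`. -/
def curryLeftEquiv : (((tensorBifunctor R).obj A).obj M ⟶ qz.{u}) ≃+ (M ⟶ leftDual A) where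
  toFun := curryLeft
  invFun := uncurryLeft
  left_inv _ := tensor_hom_ext fun _ _ ↦ rfl
  right_inv _ := rfl
  map_add' _ _ := rfl

lemma curryLeftEquiv_map_app_comp (f : A ⟶ B)
    (φ : ((tensorBifunctor R).obj B).obj M ⟶ qz.{u}) :
    curryLeftEquiv (((tensorBifunctor R).map f).app M ≫ φ) =
      curryLeftEquiv φ ≫ leftDual.map f := rfl

lemma curryLeftEquiv_obj_map_comp (g : M ⟶ N)
    (φ : ((tensorBifunctor R).obj A).obj N ⟶ qz.{u}) :
    curryLeftEquiv (((tensorBifunctor R).obj A).map g ≫ φ) = g ≫ curryLeftEquiv φ := rfl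

end Tensor

/-- A map of `ℤ`-modules is a monomorphism if all characters extend along it. -/
lemma mono_of_character_extension {V W : ModuleCat.{u} ℤ} (g : V ⟶ W)
    (h : ∀ φ : V ⟶ qz.{u}, ∃ ψ : W ⟶ qz.{u}, g ≫ ψ = φ) : Mono g := by
  rw [ModuleCat.mono_iff_injective, injective_iff_map_eq_zero]
  intro v hv
  by_contra hne
  obtain ⟨φ, hφ⟩ := exists_character_ne_zero hne
  obtain ⟨ψ, rfl⟩ := h φ
  exact hφ ((congrArg ψ.hom hv).trans (map_zero _))

lemma isFlat_iff_mono (M : ModuleCat.{u} R) :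
    IsFlat M ↔ ∀ ⦃A B : ModuleCat.{u} Rᵐᵒᵖ⦄ (f : A ⟶ B) [Mono f],
      Mono (((tensorBifunctor R).map f).app M) :=
  ⟨fun h _ _ f _ ↦ (ModuleCat.mono_iff_injective _).2 (h f ((ModuleCat.mono_iff_injective f).1 ‹_›)),
    fun h _ _ f hf ↦ (ModuleCat.mono_iff_injective _).1
      (have := (ModuleCat.mono_iff_injective f).2 hf; h f)⟩

/-- Lambek's theorem: a left module is flat if and only if its character module is injective. -/
lemma isFlat_iff_injective_rightDual (M : ModuleCat.{u} R) :
    IsFlat M ↔ Injective (rightDual M) := by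
  rw [isFlat_iff_mono]
  constructor
  · refine fun h ↦ ⟨fun {A B} g f _ ↦ ?_⟩
    have := h f
    refine ⟨curryRightEquiv (Injective.factorThru (curryRightEquiv.symm g)
      (((tensorBifunctor R).map f).app M)), ?_⟩
    rw [← curryRightEquiv_map_app_comp, Injective.comp_factorThru, AddEquiv.apply_symm_apply]
  · intro _ A B f _
    refine mono_of_character_extension _ fun φ ↦
      ⟨curryRightEquiv.symm (Injective.factorThru (curryRightEquiv φ) f), ?_⟩
    apply curryRightEquiv.injective
    rw [curryRightEquiv_map_app_comp, AddEquiv.apply_symm_apply, Injective.comp_factorThru]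

/-- For injective `f : A ⟶ B` the restriction `B⁺ → A⁺` is surjective, so a map `M → A⁺` lifts to
`B⁺`. By adjunction, every character of `A ⊗ M` extends to `B ⊗ M`. -/
lemma isFlat_of_projective (M : ModuleCat.{u} R) [Projective M] : IsFlat M := by
  rw [isFlat_iff_mono]
  intro A B f _
  have : Epi (leftDual.map f) := by
    rw [ModuleCat.epi_iff_surjective]
    intro φ
    obtain ⟨ψ, hψ⟩ := exists_factor f.hom.toAddMonoidHom (show A →+ QZ.{u} from φ) (by
      intro a ha
      obtain rfl : a = 0 := (injective_iff_map_eq_zero _).1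
        ((ModuleCat.mono_iff_injective f).1 inferInstance) a ha
      exact map_zero _)
    exact ⟨ψ, leftDual.ext fun a ↦ hψ a⟩
  refine mono_of_character_extension _ fun φ ↦
    ⟨curryLeftEquiv.symm (Projective.factorThru (curryLeftEquiv φ) (leftDual.map f)), ?_⟩
  apply curryLeftEquiv.injective
  rw [curryLeftEquiv_map_app_comp, AddEquiv.apply_symm_apply, Projective.factorThru_comp]

end Dual

/-! ### Characters of a tensor product of complexes -/

section TensorComplex

variable {R : Type u} [Ring R] (E : ChainComplex (ModuleCat.{u} Rᵐᵒᵖ) ℤ)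
  (F : ChainComplex (ModuleCat.{u} R) ℤ)

/-- The inclusion of `E_i ⊗ F_j` into the tensor product of complexes. -/
noncomputable def tensorι (i j k : ℤ) (h : i + j = k) :
    ((tensorBifunctor R).obj (E.X i)).obj (F.X j) ⟶ (tensorComplex E F).X k :=
  HomologicalComplex.ιMapBifunctor E F (tensorBifunctor R) (ComplexShape.down ℤ) i j k h

lemma tensorι_d (i j k i' j' k' : ℤ) (h : i + j = k) (hi : i' + 1 = i) (hj : j' + 1 = j)
    (hk : k' + 1 = k) :
    tensorι E F i j k h ≫ (tensorComplex E F).d k k' =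
      ((tensorBifunctor R).map (E.d i i')).app (F.X j) ≫ tensorι E F i' j k' (by lia) +
      i.negOnePow • (((tensorBifunctor R).obj (E.X i)).map (F.d j j') ≫
        tensorι E F i j' k' (by lia)) := by
  dsimp only [tensorComplex, tensorι]
  rw [HomologicalComplex.mapBifunctor.d_eq, Preadditive.comp_add,
    HomologicalComplex.mapBifunctor.ι_D₁, HomologicalComplex.mapBifunctor.ι_D₂,
    HomologicalComplex.mapBifunctor.d₁_eq (c₁ := ComplexShape.down ℤ) (c₂ := ComplexShape.down ℤ)
      _ _ _ _ (i₁' := i') hi _ _ (by dsimp; lia),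
    HomologicalComplex.mapBifunctor.d₂_eq (c₁ := ComplexShape.down ℤ) (c₂ := ComplexShape.down ℤ)
      _ _ _ _ _ (i₂' := j') hj _ (by dsimp; lia)]
  congr 1
  exact one_smul _ _

variable {E F}

lemma tensorComplex_hom_ext {k : ℤ} {P : ModuleCat.{u} ℤ} {f g : (tensorComplex E F).X k ⟶ P}
    (h : ∀ (i j : ℤ) (hij : i + j = k), tensorι E F i j k hij ≫ f = tensorι E F i j k hij ≫ g) :
    f = g :=
  HomologicalComplex.mapBifunctor.hom_ext h

lemma exists_tensorComplex_desc {k : ℤ} {P : ModuleCat.{u} ℤ}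
    (b : ∀ (i j : ℤ) (_ : i + j = k), ((tensorBifunctor R).obj (E.X i)).obj (F.X j) ⟶ P) :
    ∃ φ : (tensorComplex E F).X k ⟶ P,
      ∀ i j (hij : i + j = k), tensorι E F i j k hij ≫ φ = b i j hij :=
  ⟨HomologicalComplex.mapBifunctorDesc (K₁ := E) (K₂ := F) (F := tensorBifunctor R)
    (c := ComplexShape.down ℤ) b, fun i j hij ↦
    HomologicalComplex.ι_mapBifunctorDesc (K₁ := E) (K₂ := F) (F := tensorBifunctor R)
      (c := ComplexShape.down ℤ) b i j hij⟩

end TensorComplex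

/-! ### Elementwise and character criteria for exactness -/

section Exactness

variable {S : Type*} [Ring S]

lemma chainComplex_exactAt_iff (F : ChainComplex (ModuleCat S) ℤ) {i j k : ℤ}
    (hi : j + 1 = i) (hk : k + 1 = j) :
    F.ExactAt j ↔ ∀ x : F.X j, (F.d j k).hom x = 0 → ∃ y : F.X i, (F.d i j).hom y = x := by
  rw [F.exactAt_iff' i j k (by simp [← hi]) (by simp [← hk]), ShortComplex.moduleCat_exact_iff]
  rfl

lemma cochainComplex_exactAt_iff (F : CochainComplex (ModuleCat S) ℤ) {i j k : ℤ}
    (hi : i + 1 = j) (hk : j + 1 = k) :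
    F.ExactAt j ↔ ∀ x : F.X j, (F.d j k).hom x = 0 → ∃ y : F.X i, (F.d i j).hom y = x := by
  rw [F.exactAt_iff' i j k (by simp [← hi]) (by simp [← hk]), ShortComplex.moduleCat_exact_iff]
  rfl

/-- Exactness means that the cokernel of `S.f` embeds in `S.X₃`, and the characters of this cokernel
are the characters of `S.X₂` that kill `S.f`. -/
lemma exact_of_characters (S : ShortComplex (ModuleCat.{u} ℤ))
    (h : ∀ φ : S.X₂ ⟶ qz.{u}, S.f ≫ φ = 0 → ∃ ψ : S.X₃ ⟶ qz.{u}, S.g ≫ ψ = φ) : S.Exact := by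
  rw [S.exact_iff_mono_fromOpcycles]
  refine mono_of_character_extension _ fun φ ↦ ?_
  obtain ⟨ψ, hψ⟩ := h (S.pOpcycles ≫ φ) (by simp)
  exact ⟨ψ, by rw [← cancel_epi S.pOpcycles, S.p_fromOpcycles_assoc, hψ]⟩

end Exactness

/-! ### The complex of characters -/

section DualComplex

variable {R : Type u} [Ring R]

/-- The cochain complex of right modules of characters of a chain complex of left modules. -/
def rightDualComplex (F : ChainComplex (ModuleCat.{u} R) ℤ) :
    CochainComplex (ModuleCat.{u} Rᵐᵒᵖ) ℤ where
  X n := rightDual (F.X n)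
  d i j := rightDual.map (F.d j i)
  shape i j hij := by
    rw [F.shape j i hij]
    exact (rightDualFunctor R).map_zero _ _
  d_comp_d' i j k _ _ :=
    ((rightDualFunctor R).map_comp (F.d j i).op (F.d k j).op).symm.trans
      ((congrArg (rightDualFunctor R).map (congrArg Quiver.Hom.op (F.d_comp_d k j i))).trans
        ((rightDualFunctor R).map_zero _ _))

/-- The map on complexes of characters induced by a chain map. -/
def rightDualComplexMap {F G : ChainComplex (ModuleCat.{u} R) ℤ} (f : F ⟶ G) :
    rightDualComplex G ⟶ rightDualComplex F where
  f n := rightDual.map (f.f n)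
  comm' i j _ :=
    ((rightDualFunctor R).map_comp (f.f i).op (F.d j i).op).symm.trans
      ((congrArg (rightDualFunctor R).map (congrArg Quiver.Hom.op (f.comm j i).symm)).trans
        ((rightDualFunctor R).map_comp (G.d j i).op (f.f j).op))

lemma quasiIso_rightDualComplexMap {F G : ChainComplex (ModuleCat.{u} R) ℤ} (f : F ⟶ G)
    [QuasiIso f] : QuasiIso (rightDualComplexMap f) :=
  inferInstanceAs (QuasiIso (((rightDualFunctor R).mapHomologicalComplex
    (ComplexShape.down ℤ).symm).map
      ((HomologicalComplex.opFunctor (ModuleCat.{u} R) (ComplexShape.down ℤ)).map f.op)))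

lemma exactAt_rightDualComplex {F : ChainComplex (ModuleCat.{u} R) ℤ} {n : ℤ} (h : F.ExactAt n) :
    (rightDualComplex F).ExactAt n :=
  h.op.map (rightDualFunctor R)

end DualComplex

/-! ### DG-flatness, K-injectivity of the dual, and null-homotopies -/

section KInjective

variable {R : Type u} [Ring R]

/-- A cochain complex as a chain complex, with alternating signs. -/
def alternatingChainComplex (K : CochainComplex (ModuleCat.{u} R) ℤ) :
    ChainComplex (ModuleCat.{u} R) ℤ where
  X t := K.X (-t)
  d i j := (i + 1).negOnePow • K.d (-i) (-j)
  shape i j hij := by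
    rw [K.shape _ _ (by simp at hij ⊢; lia), smul_zero]
  d_comp_d' i j k _ _ := by
    rw [Linear.units_smul_comp, Linear.comp_units_smul, K.d_comp_d, smul_zero, smul_zero]

lemma negOnePow_smul_self {A : Type*} [AddCommGroup A] (n : ℤ) (x : A) :
    n.negOnePow • n.negOnePow • x = x := by
  rw [smul_smul, Int.units_mul_self, one_smul]

lemma acyclic_alternatingChainComplex {K : CochainComplex (ModuleCat.{u} R) ℤ} (hK : K.Acyclic) :
    (alternatingChainComplex K).Acyclic := by
  intro t
  rw [chainComplex_exactAt_iff _ rfl (sub_add_cancel t 1)]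
  intro (x : K.X (-t)) hx
  obtain ⟨y, hy⟩ := (cochainComplex_exactAt_iff K (i := -(t + 1)) (k := -(t - 1))
    (by lia) (by lia)).1 (hK (-t)) x (by
      have h : (t + 1).negOnePow • (K.d (-t) (-(t - 1))).hom x = 0 := hx
      rwa [smul_eq_zero_iff_eq] at h)
  refine ⟨(t + 1 + 1).negOnePow • y, ?_⟩
  have h : (K.d (-(t + 1)) (-t)).hom ((t + 1 + 1).negOnePow • y) = (t + 1 + 1).negOnePow • x := by
    rw [Units.smul_def, map_zsmul, hy, ← Units.smul_def]
  exact (congrArg ((t + 1 + 1).negOnePow • ·) h).trans (negOnePow_smul_self _ x)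

/-- A character that kills the boundaries kills the cycles, hence is defined on the image of the
differential and extends by injectivity of `ℚ/ℤ`. -/
lemma exists_extension_of_exactAt {T : ChainComplex (ModuleCat.{u} ℤ) ℤ} {i j k : ℤ}
    (hi : j + 1 = i) (hk : k + 1 = j) (hT : T.ExactAt j)
    (φ : T.X j ⟶ qz.{u}) (hφ : T.d i j ≫ φ = 0) : ∃ ψ : T.X k ⟶ qz.{u}, T.d j k ≫ ψ = φ := by
  rw [T.exactAt_iff' i j k (by simp [← hi]) (by simp [← hk])] at hT
  exact ⟨hT.descToInjective φ hφ, hT.comp_descToInjective φ hφ⟩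

lemma nonempty_homotopy_zero_of_eq {C : Type*} [Category* C] [Preadditive C]
    {K L : CochainComplex C ℤ} (f : K ⟶ L)
    (s : ∀ i j, K.X i ⟶ L.X j) (hs : ∀ i j, ¬ j + 1 = i → s i j = 0)
    (h : ∀ n, f.f n = K.d n (n + 1) ≫ s (n + 1) n + s n (n - 1) ≫ L.d (n - 1) n) :
    Nonempty (Homotopy f 0) := by
  refine ⟨⟨s, hs, fun n ↦ ?_⟩⟩
  rw [dNext_eq _ (show (ComplexShape.up ℤ).Rel n (n + 1) from rfl),
    prevD_eq _ (show (ComplexShape.up ℤ).Rel (n - 1) n by simp), HomologicalComplex.zero_f,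
    add_zero, h]

/-- The terms of the chain complex defined by a cochain complex. -/
def alternatingChainComplexXIso (K : CochainComplex (ModuleCat.{u} R) ℤ) (i p : ℤ)
    (h : i + p = 0) : (alternatingChainComplex K).X i ≅ K.X p :=
  K.XIsoOfEq (by lia)

lemma alternatingChainComplexXIso_inv_d (K : CochainComplex (ModuleCat.{u} R) ℤ)
    (i p i' p' : ℤ) (h : i + p = 0) (h' : i' + p' = 0) :
    (alternatingChainComplexXIso K i p h).inv ≫ (alternatingChainComplex K).d i i' =
      (i + 1).negOnePow • K.d p p' ≫ (alternatingChainComplexXIso K i' p' h').inv := by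
  dsimp [alternatingChainComplexXIso, alternatingChainComplex]
  rw [Linear.comp_units_smul, K.XIsoOfEq_inv_comp_d, K.d_comp_XIsoOfEq_inv]
  rfl

lemma d_alternatingChainComplexXIso_hom (K : CochainComplex (ModuleCat.{u} R) ℤ)
    (i p i' p' : ℤ) (h : i + p = 0) (h' : i' + p' = 0) :
    (alternatingChainComplex K).d i i' ≫ (alternatingChainComplexXIso K i' p' h').hom =
      (i + 1).negOnePow • (alternatingChainComplexXIso K i p h).hom ≫ K.d p p' := by
  rw [← cancel_epi (alternatingChainComplexXIso K i p h).inv,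
    reassoc_of% alternatingChainComplexXIso_inv_d K i p i' p' h h', Linear.comp_units_smul]
  simp

/-- The characters of a DG-flat complex form a K-injective complex. -/
lemma isKInjective_rightDualComplex {F : ChainComplex (ModuleCat.{u} R) ℤ} (hF : IsDGFlat F) :
    (rightDualComplex F).IsKInjective where
  nonempty_homotopy_zero {K} f hK := by
    -- Only the isomorphisms `E_i ≅ K^p` for `i + p = 0` and the signed differentials are retained,
    -- which avoids transport along equalities of degrees.
    obtain ⟨E, hE, e, he, he'⟩ : ∃ (E : ChainComplex (ModuleCat.{u} Rᵐᵒᵖ) ℤ) (_ : E.Acyclic)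
        (e : ∀ i p, i + p = 0 → (E.X i ≅ K.X p)), (∀ i p i' p' h h',
          (e i p h).inv ≫ E.d i i' = (i + 1).negOnePow • K.d p p' ≫ (e i' p' h').inv) ∧
        (∀ i p i' p' h h',
          E.d i i' ≫ (e i' p' h').hom = (i + 1).negOnePow • (e i p h).hom ≫ K.d p p') :=
      ⟨_, acyclic_alternatingChainComplex hK, alternatingChainComplexXIso K,
        alternatingChainComplexXIso_inv_d K, d_alternatingChainComplexXIso_hom K⟩
    obtain ⟨g, hg, hgf⟩ : ∃ g : ∀ n, K.X n ⟶ rightDual (F.X n),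
        (∀ i j, g i ≫ rightDual.map (F.d j i) = K.d i j ≫ g j) ∧ ∀ n, g n = f.f n :=
      ⟨f.f, fun i j ↦ f.comm i j, fun _ ↦ rfl⟩
    -- By adjunction `f` is a character `φ` of `(E ⊗ F)_0`. The signs in `E` make the two Leibniz
    -- terms cancel, so `φ` kills boundaries precisely because `f` is a chain map.
    obtain ⟨φ, hφ⟩ := exists_tensorComplex_desc (E := E) (F := F) (k := 0) (P := qz.{u})
      (fun i j hij ↦ curryRightEquiv.symm ((e i j hij).hom ≫ g j))
    have hd : (tensorComplex E F).d 1 0 ≫ φ = 0 := by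
      apply tensorComplex_hom_ext
      intro i j hij
      apply curryRightEquiv.injective
      rw [reassoc_of% tensorι_d E F i j 1 (i - 1) (j - 1) 0 hij (by lia) (by lia) (by lia),
        Preadditive.add_comp, Linear.units_smul_comp, Category.assoc, Category.assoc, hφ, hφ,
        map_add, Units.smul_def, map_zsmul, curryRightEquiv_map_app_comp,
        curryRightEquiv_obj_map_comp, AddEquiv.apply_symm_apply, AddEquiv.apply_symm_apply,
        reassoc_of% he' i (j - 1) (i - 1) j (by lia) (by lia),
        Category.assoc, hg, Linear.units_smul_comp, Category.assoc, Int.negOnePow_succ,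
        Units.neg_smul, Units.smul_def, neg_add_cancel, comp_zero, map_zero]
    obtain ⟨ψ, hψ⟩ := exists_extension_of_exactAt (i := 1) (j := 0) (k := -1) rfl rfl
      (hF.2 E hE 0) φ hd
    -- The components of `ψ` form the homotopy. The sign `(-1)^i` absorbs the sign of the
    -- differential of `E` in one Leibniz term and the Leibniz sign in the other.
    let s (i j : ℤ) : K.X i ⟶ rightDual (F.X j) :=
      if hij : j + 1 = i then
        i.negOnePow • ((e (-i) i (by lia)).inv ≫
          curryRightEquiv (tensorι E F (-i) j (-1) (by lia) ≫ ψ))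
      else 0
    have hs (n : ℤ) : g n = K.d n (n + 1) ≫ s (n + 1) n + s n (n - 1) ≫
        rightDual.map (F.d n (n - 1)) := by
      have h₁ : (e (-n) n (by lia)).hom ≫ g n =
          curryRightEquiv (tensorι E F (-n) n 0 (by lia) ≫ (tensorComplex E F).d 0 (-1) ≫ ψ) := by
        rw [← AddEquiv.apply_symm_apply curryRightEquiv ((e (-n) n _).hom ≫ g n), ← hφ, ← hψ]
      rw [reassoc_of% tensorι_d E F (-n) n 0 (-(n + 1)) (n - 1) (-1) (by lia) (by lia) (by lia)
        (by lia), Preadditive.add_comp, Linear.units_smul_comp, Category.assoc, Category.assoc,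
        map_add, Units.smul_def, map_zsmul, curryRightEquiv_map_app_comp,
        curryRightEquiv_obj_map_comp, ← Iso.eq_inv_comp, Preadditive.comp_add,
        reassoc_of% he (-n) n (-(n + 1)) (n + 1) (by lia) (by lia)] at h₁
      have h₂ : s (n + 1) n = (n + 1).negOnePow • (e (-(n + 1)) (n + 1) (by lia)).inv ≫
          curryRightEquiv (tensorι E F (-(n + 1)) n (-1) (by lia) ≫ ψ) := dif_pos rfl
      have h₃ : s n (n - 1) = n.negOnePow • (e (-n) n (by lia)).inv ≫
          curryRightEquiv (tensorι E F (-n) (n - 1) (-1) (by lia) ≫ ψ) := dif_pos (by lia)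
      rw [h₁, h₂, h₃, ← Units.smul_def, Linear.comp_units_smul, Linear.comp_units_smul,
        Linear.units_smul_comp, Linear.units_smul_comp, Category.assoc, Category.assoc,
        Int.negOnePow_neg, show (-n + 1).negOnePow = (n + 1).negOnePow by
          rw [Int.negOnePow_succ, Int.negOnePow_succ, Int.negOnePow_neg]]
    exact nonempty_homotopy_zero_of_eq f s (fun i j hij ↦ dif_neg hij)
      fun n ↦ (hgf n).symm.trans (hs n)

/-- The chain complex of left modules of characters of a chain complex of right modules, placed
so that the characters of the term in degree `i` are in degree `k - i`. -/
def leftDualComplex (E : ChainComplex (ModuleCat.{u} Rᵐᵒᵖ) ℤ) (k : ℤ) :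
    ChainComplex (ModuleCat.{u} R) ℤ where
  X m := leftDual (E.X (k - m))
  d m m' := (k - m' + 1).negOnePow • leftDual.map (E.d (k - m') (k - m))
  shape i j hij := by
    rw [E.shape _ _ (by simp at hij ⊢; lia), leftDual.map_zero, smul_zero]
  d_comp_d' i j l _ _ := by
    rw [Linear.units_smul_comp, Linear.comp_units_smul, ← leftDual.map_comp, E.d_comp_d,
      leftDual.map_zero, smul_zero, smul_zero]

lemma acyclic_leftDualComplex {E : ChainComplex (ModuleCat.{u} Rᵐᵒᵖ) ℤ} (hE : E.Acyclic) (k : ℤ) :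
    (leftDualComplex E k).Acyclic := by
  intro m
  rw [chainComplex_exactAt_iff _ rfl (sub_add_cancel m 1)]
  intro (x : leftDual (E.X (k - m))) hx
  obtain ⟨ψ, hψ⟩ : ∃ ψ : leftDual (E.X (k - (m + 1))),
      (leftDual.map (E.d (k - m) (k - (m + 1)))).hom ψ = x := by
    obtain ⟨ψ, hψ⟩ := exists_factor (E.d (k - m) (k - (m + 1))).hom.toAddMonoidHom
      (show E.X (k - m) →+ QZ.{u} from x) (by
        intro a ha
        obtain ⟨b, hb⟩ := (chainComplex_exactAt_iff E (i := k - (m - 1)) (k := k - (m + 1))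
          (by lia) (by lia)).1 (hE (k - m)) a ha
        have h : (k - (m - 1) + 1).negOnePow •
          (leftDual.map (E.d (k - (m - 1)) (k - m))).hom x = 0 := hx
        rw [smul_eq_zero_iff_eq] at h
        exact (congrArg x hb.symm).trans (DFunLike.congr_fun h b))
    exact ⟨ψ, leftDual.ext hψ⟩
  have h : (leftDual.map (E.d (k - m) (k - (m + 1)))).hom ((k - m + 1).negOnePow • ψ) =
      (k - m + 1).negOnePow • x := by
    rw [Units.smul_def, map_zsmul, hψ, Units.smul_def]
  exact ⟨_, (congrArg ((k - m + 1).negOnePow • ·) h).trans (negOnePow_smul_self _ x)⟩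

/-- If all chain maps from `P` to acyclic complexes are homotopic to zero, then tensoring with `P`
preserves acyclicity. -/
lemma acyclic_tensorComplex {P : ChainComplex (ModuleCat.{u} R) ℤ}
    (hP : ∀ G : ChainComplex (ModuleCat.{u} R) ℤ, G.Acyclic →
      ∀ g : P ⟶ G, ∃ s : ∀ i j, P.X i ⟶ G.X j, ∀ m n, m + 1 = n →
        g.f n = P.d n m ≫ s m n + s n (n + 1) ≫ G.d (n + 1) n)
    {E : ChainComplex (ModuleCat.{u} Rᵐᵒᵖ) ℤ} (hE : E.Acyclic) :
    (tensorComplex E P).Acyclic := by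
  intro k
  rw [(tensorComplex E P).exactAt_iff' (k + 1) k (k - 1) (by simp) (by simp)]
  apply exact_of_characters
  intro (φ : (tensorComplex E P).X k ⟶ qz.{u}) (hφ : (tensorComplex E P).d (k + 1) k ≫ φ = 0)
  suffices ∃ ψ, (tensorComplex E P).d k (k - 1) ≫ ψ = φ from this
  -- A character of `(E ⊗ P)_k` that kills boundaries is a chain map from `P` to the acyclic complex
  -- `leftDualComplex E k`; a null-homotopy of this map extends the character along the
  -- differential.
  let c (m : ℤ) : P.X m ⟶ leftDual (E.X (k - m)) :=
    curryLeftEquiv (tensorι E P (k - m) m k (by lia) ≫ φ)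
  have hc (m m' : ℤ) (h : m' + 1 = m) :
      c m ≫ leftDual.map (E.d (k - m') (k - m)) + (k - m').negOnePow • P.d m m' ≫ c m' = 0 := by
    have := congrArg curryLeftEquiv
      (congrArg (tensorι E P (k - m') m (k + 1) (by lia) ≫ ·) hφ)
    rwa [reassoc_of% tensorι_d E P (k - m') m (k + 1) (k - m) m' k (by lia) (by lia) (by lia)
      (by lia), Preadditive.add_comp, Linear.units_smul_comp, Category.assoc, Category.assoc,
      map_add, Units.smul_def, map_zsmul, curryLeftEquiv_map_app_comp,
      curryLeftEquiv_obj_map_comp, comp_zero, map_zero, ← Units.smul_def] at this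
  let g : P ⟶ leftDualComplex E k :=
    { f := c
      comm' := fun m m' h ↦ by
        change c m ≫ ((k - m' + 1).negOnePow • leftDual.map (E.d (k - m') (k - m))) =
          P.d m m' ≫ c m'
        rw [Linear.comp_units_smul, eq_neg_of_add_eq_zero_left (hc m m' h), Int.negOnePow_succ,
          Units.neg_smul, smul_neg, neg_neg, negOnePow_smul_self] }
  obtain ⟨s, hs⟩ : ∃ s : ∀ i j, P.X i ⟶ leftDual (E.X (k - j)), ∀ m n, m + 1 = n →
      c n = P.d n m ≫ s m n +
        s n (n + 1) ≫ ((k - n + 1).negOnePow • leftDual.map (E.d (k - n) (k - (n + 1)))) :=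
    hP _ (acyclic_leftDualComplex hE k) g
  have hs' (i j j' : ℤ) (h : j' = j) :
      s i j' ≫ leftDual.map (E.XIsoOfEq (show k - j = k - j' by lia)).hom = s i j := by
    subst h
    rw [E.XIsoOfEq_rfl]
    rfl
  -- With this sign the second Leibniz term becomes unsigned and the first acquires the sign of the
  -- differential of `leftDualComplex E k`.
  obtain ⟨ψ, hψ⟩ := exists_tensorComplex_desc (E := E) (F := P) (k := k - 1) (P := qz.{u})
    (fun i j hij ↦ curryLeftEquiv.symm ((k - j + 1).negOnePow •
      s j (k - i) ≫ leftDual.map (E.XIsoOfEq (show i = k - (k - i) by lia)).hom))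
  refine ⟨ψ, tensorComplex_hom_ext fun i n hin ↦ ?_⟩
  obtain rfl : i = k - n := by lia
  apply curryLeftEquiv.injective
  rw [reassoc_of% tensorι_d E P (k - n) n k (k - (n + 1)) (n - 1) (k - 1) (by lia) (by lia)
    (by lia) (by lia), Preadditive.add_comp, Linear.units_smul_comp, Category.assoc,
    Category.assoc, map_add, Units.smul_def, map_zsmul, ← Units.smul_def,
    curryLeftEquiv_map_app_comp, curryLeftEquiv_obj_map_comp, hψ, hψ,
    AddEquiv.apply_symm_apply, AddEquiv.apply_symm_apply,
    hs' _ _ _ (by lia), hs' _ _ _ (by lia), Linear.units_smul_comp, Linear.comp_units_smul,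
    show k - (n - 1) + 1 = k - n + 1 + 1 by lia, Int.negOnePow_succ (k - n + 1),
    Int.negOnePow_succ (k - n), neg_neg, negOnePow_smul_self, add_comm]
  refine Eq.trans ?_ (hs (n - 1) n (by lia)).symm
  rw [Linear.comp_units_smul, Int.negOnePow_succ]

end KInjective

/-! ### DG-flat resolutions -/

section SmallObject

universe w v u'

open MorphismProperty in
/-- A small family of monomorphisms in a Grothendieck abelian category permits the small object
argument. -/
lemma hasSmallObjectArgument_ofHoms {C : Type u'} [Category.{v} C] [Abelian C]
    [IsGrothendieckAbelian.{w} C] {ι : Type w} {A B : ι → C} (f : ∀ i, A i ⟶ B i)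
    [∀ i, Mono (f i)] : HasSmallObjectArgument.{w} (ofHoms f) := by
  -- Since `κ` exceeds the number of subobjects of each `A i`, maps out of `A i` commute with
  -- `κ`-indexed colimits of monomorphisms. The cell attachments are such chains, monomorphisms
  -- being stable under coproducts and pushouts.
  obtain ⟨κ, hκ', hκ⟩ := HasCardinalLT.exists_regular_cardinal_forall.{w}
    (fun i ↦ Shrink.{w} (Subobject (A i)))
  have : Fact κ.IsRegular := ⟨hκ'⟩
  have : Nonempty κ.ord.ToType := by simpa using hκ'.ne_zero
  have := WellFoundedLT.toOrderBot κ.ord.ToType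
  have hmono : ofHoms f ≤ monomorphisms C := by
    rintro _ _ _ ⟨i⟩
    exact inferInstanceAs (Mono (f i))
  exact ⟨κ, inferInstance, inferInstance,
    { preservesColimit {A B X Y} i hi g hg := by
        let hg' : (monomorphisms C).TransfiniteCompositionOfShape κ.ord.ToType g :=
          { toTransfiniteCompositionOfShape := hg.toTransfiniteCompositionOfShape
            map_mem j hj := by
              have := (hg.attachCells j hj).pushouts_coproducts
              simp only [ofHoms_homFamily] at this
              refine (?_ : _ ≤ monomorphisms C) _ this
              simp only [pushouts_le_iff, coproducts_le_iff]
              exact hmono }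
        have (j j' : κ.ord.ToType) (φ : j ⟶ j') : Mono (hg'.F.map φ) := hg'.mem_map φ
        apply IsGrothendieckAbelian.preservesColimit_coyoneda_obj_of_mono (Y := hg'.F) (κ := κ)
        obtain ⟨i⟩ := hi
        exact (hasCardinalLT_iff_of_equiv (equivShrink _) _).2 (hκ i) }⟩

end SmallObject

/-! ### Cofibrant complexes and the small object argument -/

section Resolution

variable {R : Type u} [Ring R]

variable (R) in
/-- The inclusion of the sphere complex `R[n-1]` into the disk complex `R → R` in degrees `n` and
`n - 1`. -/
noncomputable def sphereToDisk (n : ℤ) :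
    (HomologicalComplex.single (ModuleCat.{u} R) (ComplexShape.down ℤ) (n - 1)).obj
      (ModuleCat.of R R) ⟶
    HomologicalComplex.double (𝟙 (ModuleCat.of R R))
      (show (ComplexShape.down ℤ).Rel n (n - 1) from sub_add_cancel n 1) :=
  HomologicalComplex.mkHomFromSingle
    (HomologicalComplex.doubleXIso₁ _ _ (by lia)).inv (fun k _ ↦ by
      rw [HomologicalComplex.double_d_eq_zero₀ _ _ _ _ (by lia), comp_zero])

lemma sphereToDisk_f (n : ℤ) : (sphereToDisk R n).f (n - 1) =
    (HomologicalComplex.singleObjXSelf _ _ _).hom ≫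
      (HomologicalComplex.doubleXIso₁ _ _ (by lia)).inv :=
  HomologicalComplex.mkHomFromSingle_f _ _

instance (n : ℤ) : Mono (sphereToDisk R n) := by
  have (i : ℤ) : Mono ((sphereToDisk R n).f i) := by
    by_cases hi : i = n - 1
    · subst hi
      rw [sphereToDisk_f]
      infer_instance
    · exact (HomologicalComplex.isZero_single_obj_X _ _ _ _ hi).mono _
  exact HomologicalComplex.mono_of_mono_f _ this

variable (R) in
/-- The generating cofibrations of the projective model structure on chain complexes. -/
def generatingCofibrations : MorphismProperty (ChainComplex (ModuleCat.{u} R) ℤ) :=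
  MorphismProperty.ofHoms (fun n : ULift.{u} ℤ ↦ sphereToDisk R n.down)

instance : MorphismProperty.HasSmallObjectArgument.{u} (generatingCofibrations R) :=
  hasSmallObjectArgument_ofHoms _

lemma ofHom_toSpanSingleton_comp {M N : ModuleCat.{u} R} (f : M ⟶ N) (x : M) :
    ModuleCat.ofHom (LinearMap.toSpanSingleton R M x) ≫ f =
      ModuleCat.ofHom (LinearMap.toSpanSingleton R N (f.hom x)) := by
  apply ModuleCat.hom_ext
  apply LinearMap.ext_ring
  simp

/-- A map from the sphere is a cycle `x`, a map from the disk is an element `y` of degree `n`, and a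
diagonal filler is the element `z`. -/
lemma generatingCofibrations_rlp_iff {E E' : ChainComplex (ModuleCat.{u} R) ℤ} (p : E ⟶ E') :
    (generatingCofibrations R).rlp p ↔ ∀ (n : ℤ) (x : E.X (n - 1)) (y : E'.X n),
      (E.d (n - 1) (n - 1 - 1)).hom x = 0 → (p.f (n - 1)).hom x = (E'.d n (n - 1)).hom y →
        ∃ z : E.X n, (E.d n (n - 1)).hom z = x ∧ (p.f n).hom z = y := by
  constructor
  · intro h n x y hx hxy
    have hlp : HasLiftingProperty (sphereToDisk R n) p := h _ ⟨(⟨n⟩ : ULift.{u} ℤ)⟩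
    have sq : CommSq
        (HomologicalComplex.mkHomFromSingle (c := ComplexShape.down ℤ)
          (ModuleCat.ofHom (LinearMap.toSpanSingleton R _ x)) (fun k hk ↦ by
            obtain rfl : k = n - 1 - 1 := by simp at hk; lia
            rw [ofHom_toSpanSingleton_comp, hx, LinearMap.toSpanSingleton_zero]
            rfl))
        (sphereToDisk R n) p
        (HomologicalComplex.mkHomFromDouble _ (by lia)
          (ModuleCat.ofHom (LinearMap.toSpanSingleton R _ y))
          (ModuleCat.ofHom (LinearMap.toSpanSingleton R _ ((E'.d n (n - 1)).hom y)))
          (by rw [ofHom_toSpanSingleton_comp, Category.id_comp])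
          (fun k hk ↦ by
            rw [← ofHom_toSpanSingleton_comp, Category.assoc, E'.d_comp_d, comp_zero])) := ⟨by
      apply HomologicalComplex.from_single_hom_ext
      simp [sphereToDisk, ofHom_toSpanSingleton_comp, hxy]⟩
    have h₁ := congrArg (fun f ↦ HomologicalComplex.Hom.f f (n - 1)) sq.fac_left
    have h₂ := congrArg (fun f ↦ HomologicalComplex.Hom.f f n) sq.fac_right
    rw [HomologicalComplex.comp_f, sphereToDisk_f,
      HomologicalComplex.mkHomFromSingle_f, Category.assoc, cancel_epi] at h₁
    rw [HomologicalComplex.comp_f, HomologicalComplex.mkHomFromDouble_f₀, ← Iso.inv_comp_eq] at h₂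
    have h₃ : ((HomologicalComplex.doubleXIso₀ (𝟙 (ModuleCat.of R R))
        (show (ComplexShape.down ℤ).Rel n (n - 1) from sub_add_cancel n 1)).inv ≫
          sq.lift.f n) ≫ E.d n (n - 1) = ModuleCat.ofHom (LinearMap.toSpanSingleton R _ x) := by
      refine Eq.trans ?_ h₁
      rw [Category.assoc, sq.lift.comm, HomologicalComplex.double_d _ _ (by lia)]
      simp
    refine ⟨((HomologicalComplex.doubleXIso₀ (𝟙 (ModuleCat.of R R)) _).inv ≫
      sq.lift.f n).hom (1 : R), ?_, ?_⟩
    · exact congr($(h₃).hom (1 : R)).trans (one_smul R x)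
    · refine Eq.trans ?_ (congr($(h₂).hom (1 : R)).trans (one_smul R y))
      rfl
  · rintro h _ _ _ ⟨⟨n⟩⟩
    refine ⟨fun {f g} (sq : CommSq f (sphereToDisk R n) p g) ↦ ?_⟩
    let e₀ := HomologicalComplex.doubleXIso₀ (𝟙 (ModuleCat.of R R))
        (show (ComplexShape.down ℤ).Rel n (n - 1) from sub_add_cancel n 1)
    let e₁ := HomologicalComplex.doubleXIso₁ (𝟙 (ModuleCat.of R R))
        (show (ComplexShape.down ℤ).Rel n (n - 1) from sub_add_cancel n 1) (by lia)
    let e := HomologicalComplex.singleObjXSelf (ComplexShape.down ℤ) (n - 1) (ModuleCat.of R R)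
    let x₀ : ModuleCat.of R R ⟶ E.X (n - 1) := e.inv ≫ f.f (n - 1)
    let y₀ : ModuleCat.of R R ⟶ E'.X n := e₀.inv ≫ g.f n
    have hx₀ : x₀ ≫ E.d (n - 1) (n - 1 - 1) = 0 := by simp [x₀]
    have hd : e₀.inv ≫ (HomologicalComplex.double _ _).d n (n - 1) = e₁.inv := by
      rw [HomologicalComplex.double_d _ _ (by lia)]
      simp [e₀, e₁]
    have hxy₀ : x₀ ≫ p.f (n - 1) = y₀ ≫ E'.d n (n - 1) := by
      have := congrArg (fun f ↦ HomologicalComplex.Hom.f f (n - 1)) sq.w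
      dsimp only [HomologicalComplex.comp_f] at this
      rw [sphereToDisk_f] at this
      dsimp only [x₀, y₀]
      rw [Category.assoc, this, Category.assoc, Category.assoc, Iso.inv_hom_id_assoc, g.comm,
        reassoc_of% hd]
    obtain ⟨z, hz₁, hz₂⟩ := h n (x₀.hom (1 : R)) (y₀.hom (1 : R)) congr($(hx₀).hom (1 : R))
      congr($(hxy₀).hom (1 : R))
    have hz₁' : ModuleCat.ofHom (LinearMap.toSpanSingleton R _ z) ≫ E.d n (n - 1) = x₀ := by
      rw [ofHom_toSpanSingleton_comp, hz₁]
      exact ModuleCat.hom_ext (LinearMap.ext_ring (one_smul R _))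
    have hz₂' : ModuleCat.ofHom (LinearMap.toSpanSingleton R _ z) ≫ p.f n = y₀ := by
      rw [ofHom_toSpanSingleton_comp, hz₂]
      exact ModuleCat.hom_ext (LinearMap.ext_ring (one_smul R _))
    refine ⟨⟨⟨HomologicalComplex.mkHomFromDouble _ (by lia)
      (ModuleCat.ofHom (LinearMap.toSpanSingleton R _ z)) x₀
      (by rw [hz₁', Category.id_comp]) (fun k hk ↦ ?_), ?_, ?_⟩⟩⟩
    · obtain rfl : k = n - 1 - 1 := by simp at hk; lia
      exact hx₀
    · apply HomologicalComplex.from_single_hom_ext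
      rw [HomologicalComplex.comp_f, sphereToDisk_f,
        HomologicalComplex.mkHomFromDouble_f₁]
      simp [x₀, e]
    · apply HomologicalComplex.from_double_hom_ext
      · rw [HomologicalComplex.comp_f, HomologicalComplex.mkHomFromDouble_f₀, Category.assoc,
          hz₂', Iso.hom_inv_id_assoc]
      · rw [HomologicalComplex.comp_f, HomologicalComplex.mkHomFromDouble_f₁, Category.assoc,
          hxy₀, Category.assoc, g.comm, reassoc_of% hd, Iso.hom_inv_id_assoc]

/-- Trivial fibrations of chain complexes, that is, surjective quasi-isomorphisms. -/
def IsTrivialFibration {E E' : ChainComplex (ModuleCat.{u} R) ℤ} (p : E ⟶ E') : Prop :=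
  ∀ (i j k : ℤ), j + 1 = i → k + 1 = j → ∀ (x : E.X j) (y : E'.X i),
    (E.d j k).hom x = 0 → (p.f j).hom x = (E'.d i j).hom y →
      ∃ z : E.X i, (E.d i j).hom z = x ∧ (p.f i).hom z = y

lemma generatingCofibrations_rlp_iff_isTrivialFibration
    {E E' : ChainComplex (ModuleCat.{u} R) ℤ} (p : E ⟶ E') :
    (generatingCofibrations R).rlp p ↔ IsTrivialFibration p := by
  rw [generatingCofibrations_rlp_iff]
  constructor
  · intro h i j k hi hk
    obtain rfl : j = i - 1 := by lia
    obtain rfl : k = i - 1 - 1 := by lia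
    exact h i
  · intro h n
    exact h n (n - 1) (n - 1 - 1) (by lia) (by lia)

/-- The product of the disk complexes of a module in all degrees. -/
def diskProduct (A : ModuleCat.{u} R) : ChainComplex (ModuleCat.{u} R) ℤ :=
  ChainComplex.of (fun _ ↦ ModuleCat.of R (A × A))
    (fun _ ↦ ModuleCat.ofHom ((LinearMap.inr R A A).comp (LinearMap.fst R A A)))
    (fun _ ↦ rfl)

lemma diskProduct_d (A : ModuleCat.{u} R) (n : ℤ) : (diskProduct A).d (n + 1) n =
    ModuleCat.ofHom ((LinearMap.inr R A A).comp (LinearMap.fst R A A)) :=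
  ChainComplex.of_d (fun _ ↦ ModuleCat.of R (A × A))
    (fun _ ↦ ModuleCat.ofHom ((LinearMap.inr R A A).comp (LinearMap.fst R A A))) n

/-- The map of products of disk complexes induced by a map of modules. -/
def diskProductMap {A B : ModuleCat.{u} R} (f : A ⟶ B) : diskProduct A ⟶ diskProduct B where
  f _ := ModuleCat.ofHom (f.hom.prodMap f.hom)
  comm' i j h := by
    obtain rfl : j + 1 = i := h
    rw [diskProduct_d, diskProduct_d]
    refine ModuleCat.hom_ext (LinearMap.ext fun x ↦ ?_)
    exact Prod.ext (map_zero f.hom).symm rfl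

lemma isTrivialFibration_diskProductMap {A B : ModuleCat.{u} R} (f : A ⟶ B) [Epi f] :
    IsTrivialFibration (diskProductMap f) := by
  rintro _ _ k rfl rfl (x : A × A) (y : B × B) hx hxy
  rw [diskProduct_d] at hx hxy ⊢
  obtain ⟨c, hc⟩ := (ModuleCat.epi_iff_surjective f).1 inferInstance y.2
  refine ⟨((x.2, c) : A × A), ?_, ?_⟩
  · exact Prod.ext (congrArg Prod.snd hx).symm rfl
  · exact Prod.ext (congrArg Prod.snd hxy) hc

/-- The chain map to a product of disk complexes defined by a family of maps. -/
def toDiskProduct {P : ChainComplex (ModuleCat.{u} R) ℤ} {A : ModuleCat.{u} R}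
    (v : ∀ n, P.X n ⟶ A) : P ⟶ diskProduct A where
  f n := ModuleCat.ofHom ((P.d n (n - 1) ≫ v (n - 1)).hom.prod (v n).hom)
  comm' i j h := by
    obtain rfl : j + 1 = i := h
    rw [diskProduct_d]
    refine ModuleCat.hom_ext (LinearMap.ext fun x ↦ ?_)
    have h (m : ℤ) (hm : m = j) : P.d (j + 1) m ≫ v m = P.d (j + 1) j ≫ v j := by rw [hm]
    refine Prod.ext ?_ congr($(h (j + 1 - 1) (by lia)).hom x)
    have h' : P.d (j + 1) j ≫ P.d j (j - 1) ≫ v (j - 1) = 0 := by simp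
    exact congr($(h'.symm).hom x)

/-- The differential of the path complex of a chain complex. -/
def pathComplexD (G : ChainComplex (ModuleCat.{u} R) ℤ) (n : ℤ) :
    ModuleCat.of R (G.X (n + 1) × G.X (n + 1 + 1)) ⟶ ModuleCat.of R (G.X n × G.X (n + 1)) :=
  ModuleCat.ofHom (((G.d (n + 1) n).hom.comp (LinearMap.fst R _ _)).prod
    (LinearMap.fst R _ _ - (G.d (n + 1 + 1) (n + 1)).hom.comp (LinearMap.snd R _ _)))

/-- The path complex of a chain complex. -/
def pathComplex (G : ChainComplex (ModuleCat.{u} R) ℤ) : ChainComplex (ModuleCat.{u} R) ℤ :=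
  ChainComplex.of (fun n ↦ ModuleCat.of R (G.X n × G.X (n + 1))) (pathComplexD G)
    (fun n ↦ by
      refine ModuleCat.hom_ext (LinearMap.ext fun x ↦ Prod.ext ?_ ?_)
      · exact congr($(G.d_comp_d (n + 1 + 1) (n + 1) n).hom x.1)
      · have h := congr($(G.d_comp_d (n + 1 + 1 + 1) (n + 1 + 1) (n + 1)).hom x.2)
        change (G.d (n + 1 + 1) (n + 1)).hom x.1 - (G.d (n + 1 + 1) (n + 1)).hom
          (x.1 - (G.d (n + 1 + 1 + 1) (n + 1 + 1)).hom x.2) = 0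
        rw [map_sub, sub_sub_cancel]
        exact h)

lemma pathComplex_d (G : ChainComplex (ModuleCat.{u} R) ℤ) (n : ℤ) :
    (pathComplex G).d (n + 1) n = pathComplexD G n :=
  ChainComplex.of_d (fun n ↦ ModuleCat.of R (G.X n × G.X (n + 1))) (pathComplexD G) n

/-- The projection from the path complex. -/
def pathComplexFst (G : ChainComplex (ModuleCat.{u} R) ℤ) : pathComplex G ⟶ G where
  f n := ModuleCat.ofHom (LinearMap.fst R (G.X n) (G.X (n + 1)))
  comm' i j h := by
    obtain rfl : j + 1 = i := h
    rw [pathComplex_d]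
    rfl

/-- For a cycle `x = (x₁, x₂)` one has `x₁ = d x₂`. If also `x₁ = d y`, then `y - x₂` is a cycle,
hence some `d z`, and `(y, z)` is the required lift. -/
lemma isTrivialFibration_pathComplexFst {G : ChainComplex (ModuleCat.{u} R) ℤ}
    (hG : G.Acyclic) : IsTrivialFibration (pathComplexFst G) := by
  rintro _ _ k rfl rfl (x : G.X (k + 1) × G.X (k + 1 + 1)) (y : G.X (k + 1 + 1)) hx hxy
  rw [pathComplex_d] at hx
  rw [pathComplex_d]
  have hx₂ : x.1 - (G.d (k + 1 + 1) (k + 1)).hom x.2 = 0 := congrArg Prod.snd hx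
  replace hxy : x.1 = (G.d (k + 1 + 1) (k + 1)).hom y := hxy
  obtain ⟨z, hz⟩ := (chainComplex_exactAt_iff G rfl rfl).1 (hG (k + 1 + 1)) (y - x.2) (by
    rw [map_sub, ← hxy, hx₂])
  refine ⟨((y, z) : G.X (k + 1 + 1) × G.X (k + 1 + 1 + 1)), Prod.ext hxy.symm ?_, rfl⟩
  change y - (G.d (k + 1 + 1 + 1) (k + 1 + 1)).hom z = x.2
  rw [hz, sub_sub_cancel]

/-- A chain complex is cofibrant for the projective model structure if maps from it lift along all
trivial fibrations. -/
def IsCofibrant (P : ChainComplex (ModuleCat.{u} R) ℤ) : Prop :=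
  ∀ ⦃E E' : ChainComplex (ModuleCat.{u} R) ℤ⦄ (p : E ⟶ E'), IsTrivialFibration p →
    ∀ f : P ⟶ E', ∃ l : P ⟶ E, l ≫ p = f

/-- The small object argument is applied to `0 → N`. -/
lemma exists_cofibrant_resolution (N : ChainComplex (ModuleCat.{u} R) ℤ) :
    ∃ (P : ChainComplex (ModuleCat.{u} R) ℤ) (π : P ⟶ N), IsCofibrant P ∧
      IsTrivialFibration π := by
  let fac := MorphismProperty.factorizationData (generatingCofibrations R).rlp.llp
    (generatingCofibrations R).rlp (initial.to N)
  refine ⟨fac.Z, fac.p, fun E E' p hp f ↦ ?_,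
    (generatingCofibrations_rlp_iff_isTrivialFibration _).1 fac.hp⟩
  have := fac.hi p ((generatingCofibrations_rlp_iff_isTrivialFibration _).2 hp)
  have sq : CommSq (initial.to E) fac.i p f := ⟨initial.hom_ext _ _⟩
  exact ⟨sq.lift, sq.fac_right⟩

/-- Chain maps to `diskProduct A` are arbitrary families `P.X m ⟶ A`. The family equal to `f` in
degree `n` and zero elsewhere turns the lifting problem for modules into one for complexes. -/
lemma IsCofibrant.projective {P : ChainComplex (ModuleCat.{u} R) ℤ} (hP : IsCofibrant P) (n : ℤ) :
    Projective (P.X n) where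
  factors {B A} f e _ := by
    let v : ∀ m, P.X m ⟶ A := Function.update (fun _ ↦ 0) n f
    obtain ⟨l, hl⟩ := hP _ (isTrivialFibration_diskProductMap e) (toDiskProduct v)
    refine ⟨l.f n ≫ ModuleCat.ofHom (LinearMap.snd R B B), ?_⟩
    have h : v n = f := by simp [v]
    rw [← h]
    exact congrArg (fun φ ↦ φ.f n ≫ ModuleCat.ofHom (LinearMap.snd R A A)) hl

/-- A lift of `g` to the path complex of `G` is a null-homotopy of `g`, given by the second
components. -/
lemma IsCofibrant.exists_homotopy {P : ChainComplex (ModuleCat.{u} R) ℤ} (hP : IsCofibrant P)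
    (G : ChainComplex (ModuleCat.{u} R) ℤ) (hG : G.Acyclic) (g : P ⟶ G) :
    ∃ s : ∀ i j, P.X i ⟶ G.X j, ∀ m n, m + 1 = n →
      g.f n = P.d n m ≫ s m n + s n (n + 1) ≫ G.d (n + 1) n := by
  obtain ⟨l, hl⟩ := hP _ (isTrivialFibration_pathComplexFst hG) g
  let t (n : ℤ) : P.X n ⟶ G.X (n + 1) := l.f n ≫ ModuleCat.ofHom (LinearMap.snd R _ _)
  let s (i j : ℤ) : P.X i ⟶ G.X j := if h : i + 1 = j then t i ≫ (G.XIsoOfEq h).hom else 0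
  have hs (n : ℤ) : s n (n + 1) = t n := (dif_pos rfl).trans (by simp)
  refine ⟨s, ?_⟩
  rintro m _ rfl
  rw [hs, hs]
  have h := l.comm (m + 1) m
  rw [pathComplex_d] at h
  refine ModuleCat.hom_ext (LinearMap.ext fun x ↦ ?_)
  have h₁ : ((l.f (m + 1)).hom x).1 = (g.f (m + 1)).hom x := congr($(hl).f (m + 1) |>.hom x)
  have h₂ : ((l.f (m + 1)).hom x).1 - (G.d (m + 1 + 1) (m + 1)).hom ((t (m + 1)).hom x) =
    (t m).hom ((P.d (m + 1) m).hom x) := congrArg Prod.snd congr($(h).hom x)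
  rw [h₁] at h₂
  exact sub_eq_iff_eq_add.1 h₂

lemma IsCofibrant.isDGFlat {P : ChainComplex (ModuleCat.{u} R) ℤ} (hP : IsCofibrant P) :
    IsDGFlat P :=
  ⟨fun n ↦ have := hP.projective n; isFlat_of_projective _,
    fun _ hE ↦ acyclic_tensorComplex hP.exists_homotopy hE⟩

lemma IsTrivialFibration.quasiIso {E E' : ChainComplex (ModuleCat.{u} R) ℤ} {p : E ⟶ E'}
    (hp : IsTrivialFibration p) : QuasiIso p := by
  have lift (i j k : ℤ) (hi : j + 1 = i) (hk : k + 1 = j) {A : ModuleCat.{u} R} (x : A ⟶ E.X j)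
      (y : A ⟶ E'.X i) (hx : x ≫ E.d j k = 0) (hxy : x ≫ p.f j = y ≫ E'.d i j) :
      ∃ (A' : ModuleCat.{u} R) (π : A' ⟶ A) (_ : Epi π) (z : A' ⟶ E.X i),
        z ≫ E.d i j = π ≫ x ∧ z ≫ p.f i = π ≫ y := by
    -- The elementwise choice `z` need not be linear, so `A` is covered by the free module on its
    -- elements.
    choose z hz using fun a : A ↦ hp i j k hi hk (x.hom a) (y.hom a)
      congr($(hx).hom a) congr($(hxy).hom a)
    refine ⟨ModuleCat.of R (A →₀ R), ModuleCat.ofHom (Finsupp.linearCombination R id), ?_,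
      ModuleCat.ofHom (Finsupp.linearCombination R z), ?_, ?_⟩
    · rw [ModuleCat.epi_iff_surjective]
      exact Finsupp.linearCombination_id_surjective R A
    · refine ModuleCat.hom_ext (Finsupp.lhom_ext' fun a ↦ LinearMap.ext_ring ?_)
      simp [(hz a).1]
    · refine ModuleCat.hom_ext (Finsupp.lhom_ext' fun a ↦ LinearMap.ext_ring ?_)
      simp [(hz a).2]
  rw [quasiIso_iff]
  intro j
  rw [quasiIsoAt_iff_isIso_homologyMap]
  have h₁ : Mono (HomologicalComplex.homologyMap p j) := by
    rw [HomologicalComplex.mono_homologyMap_iff_up_to_refinements p (j + 1) j (j - 1)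
      (by simp) (by simp)]
    intro A x hx y hxy
    obtain ⟨A', π, hπ, z, hz, -⟩ := lift (j + 1) j (j - 1) rfl (by lia) x y hx hxy
    exact ⟨A', π, hπ, z, hz.symm⟩
  have h₂ : Epi (HomologicalComplex.homologyMap p j) := by
    rw [HomologicalComplex.epi_homologyMap_iff_up_to_refinements p (j + 1) j (j - 1)
      (by simp) (by simp)]
    intro A y hy
    obtain ⟨A', π, hπ, z, hz, hz'⟩ := lift j (j - 1) (j - 1 - 1) (by lia) (by lia) 0 y
      (by simp) (by simp [hy])
    exact ⟨A', π, hπ, z, by rw [hz, comp_zero], 0, by rw [hz', zero_comp, add_zero]⟩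
  exact isIso_of_mono_of_epi _

/-- Every complex has a DG-flat resolution. -/
lemma exists_isDGFlat_resolution (N : ChainComplex (ModuleCat.{u} R) ℤ) :
    ∃ (P : ChainComplex (ModuleCat.{u} R) ℤ) (π : P ⟶ N), IsDGFlat P ∧ QuasiIso π := by
  obtain ⟨P, π, hP, hπ⟩ := exists_cofibrant_resolution N
  exact ⟨P, π, hP.isDGFlat, hπ.quasiIso⟩

end Resolution

/-! ### Comparison of DG-flat complexes -/

section Splitting

variable {C : Type*} [Category* C] [Abelian C]

/-- A cochain complex splits at `i → j` if the inclusion of the cycles in degree `j` lifts along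
the differential. -/
def SplitsAt (X : CochainComplex C ℤ) (i j : ℤ) : Prop :=
  ∃ s : X.cycles j ⟶ X.X i, s ≫ X.d i j = X.iCycles j

/-- Exactness at `j` makes `0 → Z^i → X^i → Z^j → 0` exact. With `X^i` injective, this sequence
splits iff `Z^i` is injective. -/
lemma splitsAt_iff_injective_cycles {X : CochainComplex C ℤ} {i j : ℤ} (hij : i + 1 = j)
    [Injective (X.X i)] (hX : X.ExactAt j) : SplitsAt X i j ↔ Injective (X.cycles i) := by
  constructor
  · rintro ⟨s, hs⟩
    -- The map `x ↦ x - s (d x)` retracts `X^i` onto its cycles.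
    let r : X.X i ⟶ X.cycles i := X.liftCycles (𝟙 _ - X.toCycles i j ≫ s) j (by simp [← hij])
      (by rw [Preadditive.sub_comp, Category.id_comp, Category.assoc, hs, X.toCycles_i, sub_self])
    have hr : X.iCycles i ≫ r = 𝟙 _ := by
      rw [← cancel_mono (X.iCycles i), Category.assoc, X.liftCycles_i, Preadditive.comp_sub,
        Category.comp_id, Category.id_comp, sub_eq_self, ← Category.assoc]
      convert zero_comp
      rw [← cancel_mono (X.iCycles j), Category.assoc, X.toCycles_i, X.iCycles_d, zero_comp]
    exact Retract.injective ⟨X.iCycles i, r, hr⟩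
  · intro _
    let r := Injective.factorThru (𝟙 (X.cycles i)) (X.iCycles i)
    have hr : X.iCycles i ≫ r = 𝟙 _ := Injective.comp_factorThru _ _
    let S : ShortComplex C := ShortComplex.mk (X.iCycles i) (X.toCycles i j) (by
      rw [← cancel_mono (X.iCycles j), Category.assoc, X.toCycles_i, X.iCycles_d, zero_comp])
    have hS : S.Exact := S.exact_of_f_is_kernel
      (isKernelOfComp (X.iCycles j) (X.d i j) (X.cyclesIsKernel i j (by simp [← hij])) S.zero
        (X.toCycles_i i j))
    have : Epi S.g := by
      have h : (ComplexShape.up ℤ).prev j = i := (ComplexShape.up ℤ).prev_eq' hij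
      clear_value r
      subst h
      exact (X.sc j).exact_iff_epi_toCycles.1 hX
    have hr' : S.f ≫ (𝟙 _ - r ≫ X.iCycles i) = 0 := by
      rw [Preadditive.comp_sub, reassoc_of% hr, Category.comp_id, sub_self]
    refine ⟨hS.desc _ hr', ?_⟩
    rw [← cancel_epi S.g, hS.g_desc_assoc, Preadditive.sub_comp, Category.assoc, X.iCycles_d]
    simp [S]

/-- On cycles the homotopy says that the composite `g ≫ f` differs from the identity by `h ≫ d`. The
section transported along `g` and `f` is therefore corrected by `h`. -/
lemma SplitsAt.of_homotopy {X X' : CochainComplex C ℤ} (f : X ⟶ X') (g : X' ⟶ X)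
    (h : Homotopy (g ≫ f) (𝟙 X')) {i j : ℤ} (hij : i + 1 = j) (hX : SplitsAt X i j) :
    SplitsAt X' i j := by
  obtain ⟨s, hs⟩ := hX
  refine ⟨HomologicalComplex.cyclesMap g j ≫ s ≫ f.f i - X'.iCycles j ≫ h.hom j i, ?_⟩
  have hc := h.comm j
  rw [dNext_eq _ (show (ComplexShape.up ℤ).Rel j (j + 1) from rfl),
    prevD_eq _ (show (ComplexShape.up ℤ).Rel i j from hij)] at hc
  have hc' := congrArg (X'.iCycles j ≫ ·) hc
  simp only [Preadditive.comp_add, HomologicalComplex.iCycles_d_assoc, zero_comp, zero_add,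
    HomologicalComplex.comp_f, HomologicalComplex.id_f, Category.comp_id] at hc'
  simp only [Preadditive.sub_comp, Category.assoc, f.comm, reassoc_of% hs,
    HomologicalComplex.cyclesMap_i_assoc, hc', add_sub_cancel_left]

end Splitting

/-! ### Homotopy equivalence of K-injective complexes -/

section Derived

-- Morphisms in the derived category to a K-injective complex are homotopy classes of chain maps, so
-- both directions of `e` and the relation between them lift.
attribute [local instance] HasDerivedCategory.standard in
lemma exists_homotopyEquiv {C : Type*} [Category* C] [Abelian C] {L L' : CochainComplex C ℤ}
    [L.IsKInjective] [L'.IsKInjective]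
    (e : DerivedCategory.Q.obj L ≅ DerivedCategory.Q.obj L') :
    ∃ (f : L ⟶ L') (g : L' ⟶ L), Nonempty (Homotopy (g ≫ f) (𝟙 L')) := by
  let e' := (DerivedCategory.quotientCompQhIso C).app L ≪≫ e ≪≫
    ((DerivedCategory.quotientCompQhIso C).app L').symm
  obtain ⟨f, hf⟩ := (CochainComplex.IsKInjective.Qh_map_bijective
    ((HomotopyCategory.quotient _ _).obj L) L').surjective e'.hom
  obtain ⟨g, hg⟩ := (CochainComplex.IsKInjective.Qh_map_bijective
    ((HomotopyCategory.quotient _ _).obj L') L).surjective e'.inv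
  obtain ⟨f, rfl⟩ := (HomotopyCategory.quotient _ _).map_surjective f
  obtain ⟨g, rfl⟩ := (HomotopyCategory.quotient _ _).map_surjective g
  refine ⟨f, g, ⟨HomotopyCategory.homotopyOfEq _ _ ?_⟩⟩
  apply (CochainComplex.IsKInjective.Qh_map_bijective _ L').injective
  rw [Functor.map_comp, Functor.map_comp, hf, hg, e'.inv_hom_id]
  exact ((HomotopyCategory.quotient _ _ ⋙ DerivedCategory.Qh).map_id L').symm

attribute [local instance] HasDerivedCategory.standard in
lemma QuasiIsomorphic.nonempty_iso {R : Type u} [Ring R] {X Y : ChainComplex (ModuleCat.{u} R) ℤ}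
    (h : QuasiIsomorphic X Y) :
    Nonempty (DerivedCategory.Q.obj (rightDualComplex X) ≅
      DerivedCategory.Q.obj (rightDualComplex Y)) := by
  induction h with
  | rel X Y h =>
    obtain ⟨f, hf⟩ := h
    have := quasiIso_rightDualComplexMap f
    exact ⟨(asIso (DerivedCategory.Q.map (rightDualComplexMap f))).symm⟩
  | refl X => exact ⟨Iso.refl _⟩
  | symm X Y _ h => exact ⟨h.some.symm⟩
  | trans X Y Z _ _ h h' => exact ⟨h.some ≪≫ h'.some⟩

end Derived

/-! ### Independence of the DG-flat complex -/

section Transfer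

variable {R : Type u} [Ring R]

/-- The cycles of the complex of characters are the characters of the cokernel. -/
noncomputable def rightDualComplexCyclesIso (F : ChainComplex (ModuleCat.{u} R) ℤ) (j : ℤ) :
    (rightDualComplex F).cycles j ≅ rightDual (F.opcycles j) :=
  ((F.sc j).op.mapCyclesIso (rightDualFunctor R)) ≪≫
    (rightDualFunctor R).mapIso (F.sc j).cyclesOpIso

lemma isFlat_opcycles_iff (F : ChainComplex (ModuleCat.{u} R) ℤ) (j : ℤ) :
    IsFlat (F.opcycles j) ↔ Injective ((rightDualComplex F).cycles j) := by
  rw [isFlat_iff_injective_rightDual]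
  exact ⟨fun _ ↦ Injective.of_iso (rightDualComplexCyclesIso F j).symm inferInstance,
    fun _ ↦ Injective.of_iso (rightDualComplexCyclesIso F j) inferInstance⟩

lemma isFlat_opcycles_iff_splitsAt {F : ChainComplex (ModuleCat.{u} R) ℤ} {i j : ℤ}
    (hij : i + 1 = j) (hF : IsFlat (F.X i)) (hj : F.ExactAt j) :
    IsFlat (F.opcycles i) ↔ SplitsAt (rightDualComplex F) i j := by
  have : Injective ((rightDualComplex F).X i) := (isFlat_iff_injective_rightDual _).1 hF
  rw [isFlat_opcycles_iff, splitsAt_iff_injective_cycles hij (exactAt_rightDualComplex hj)]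

/-- Flatness of a cokernel above the supremum of the homology does not depend on the chosen
DG-flat complex. -/
lemma IsDGFlat.isFlat_opcycles {F F' : ChainComplex (ModuleCat.{u} R) ℤ} (hF : IsDGFlat F)
    (hF' : IsDGFlat F') (h : QuasiIsomorphic F F') {i j : ℤ} (hij : i + 1 = j)
    (hj : F.ExactAt j) (hj' : F'.ExactAt j) (hi : IsFlat (F.opcycles i)) :
    IsFlat (F'.opcycles i) := by
  rw [isFlat_opcycles_iff_splitsAt hij (hF.1 i) hj] at hi
  rw [isFlat_opcycles_iff_splitsAt hij (hF'.1 i) hj']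
  have := isKInjective_rightDualComplex hF
  have := isKInjective_rightDualComplex hF'
  obtain ⟨f, g, ⟨H⟩⟩ := exists_homotopyEquiv h.nonempty_iso.some
  exact hi.of_homotopy f g H hij

end Transfer

/-! ### Gorenstein flat modules of finite flat dimension -/

section FiniteFlatDimension

variable {R : Type u} [Ring R]

/-- If `I ⊗ T` is exact, then maps from `I` to the complex of characters of `T` lift. -/
lemma exists_lift_of_exactAt {I : ModuleCat.{u} Rᵐᵒᵖ} {T : ChainComplex (ModuleCat.{u} R) ℤ}
    {i j k : ℤ} (hi : j + 1 = i) (hk : k + 1 = j) (hT : (moduleTensorComplex I T).ExactAt j)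
    (v : I ⟶ rightDual (T.X j)) (hv : v ≫ rightDual.map (T.d i j) = 0) :
    ∃ w : I ⟶ rightDual (T.X k), w ≫ rightDual.map (T.d j k) = v := by
  obtain ⟨ψ, hψ⟩ : ∃ ψ : ((tensorBifunctor R).obj I).obj (T.X k) ⟶ qz.{u},
      ((tensorBifunctor R).obj I).map (T.d j k) ≫ ψ = curryRightEquiv.symm v :=
    exists_extension_of_exactAt hi hk hT (curryRightEquiv.symm v) (by
      suffices ((tensorBifunctor R).obj I).map (T.d i j) ≫ curryRightEquiv.symm v = 0 from this
      apply curryRightEquiv.injective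
      rw [curryRightEquiv_obj_map_comp, AddEquiv.apply_symm_apply, hv, map_zero])
  exact ⟨curryRightEquiv ψ, by
    rw [← curryRightEquiv_obj_map_comp, hψ, AddEquiv.apply_symm_apply]⟩

/-- The character module of a Gorenstein flat module is the kernel of a map `q : U → V` with `U` injective,
and maps from injective modules to `V` that are annihilated by a suitable `r : V → W` lift
along `q`. -/
lemma IsGorensteinFlat.exists_coresolution {M : ModuleCat.{u} R} (hM : IsGorensteinFlat M) :
    ∃ (U V W : ModuleCat.{u} Rᵐᵒᵖ) (i : rightDual M ⟶ U) (q : U ⟶ V) (r : V ⟶ W) (w : i ≫ q = 0),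
      Injective U ∧ Mono i ∧ (ShortComplex.mk i q w).Exact ∧ q ≫ r = 0 ∧
      ∀ L : ModuleCat.{u} Rᵐᵒᵖ, Injective L → ∀ v : L ⟶ V, v ≫ r = 0 → ∃ w : L ⟶ U, w ≫ q = v := by
  obtain ⟨T, hT, hflat, htensor, ⟨e⟩⟩ := hM
  have hepi : Epi (T.toCycles 1 0) := by
    have h : (ComplexShape.down ℤ).prev 0 = 1 := by simp
    have := (T.sc 0).exact_iff_epi_toCycles.1 (hT 0)
    rw [← h]
    exact this
  let p : T.X 1 ⟶ M := T.toCycles 1 0 ≫ e.inv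
  have hdp : T.d 2 1 ≫ p = 0 := by
    dsimp [p]
    rw [← Category.assoc]
    convert zero_comp
    rw [← cancel_mono (T.iCycles 0), Category.assoc, T.toCycles_i, T.d_comp_d, zero_comp]
  have hexact : (ShortComplex.mk (T.d 2 1) p hdp).Exact := by
    rw [ShortComplex.moduleCat_exact_iff]
    intro x hx
    refine (chainComplex_exactAt_iff T (i := 2) (k := 0) (by lia) (by lia)).1 (hT 1) x ?_
    have h : p ≫ e.hom ≫ T.iCycles 0 = T.d 1 0 := by simp [p]
    rw [← h]
    exact (congrArg (e.hom ≫ T.iCycles 0).hom hx).trans (map_zero _)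
  have hd : T.d 3 2 ≫ T.d 2 1 = 0 := T.d_comp_d _ _ _
  have : Mono ((rightDualFunctor R).map p.op) := inferInstance
  exact ⟨rightDual (T.X 1), rightDual (T.X 2), rightDual (T.X 3), rightDual.map p,
    rightDual.map (T.d 2 1), rightDual.map (T.d 3 2), _,
    (isFlat_iff_injective_rightDual _).1 (hflat 1), this, hexact.op.map (rightDualFunctor R),
    (rightDualComplex T).d_comp_d 1 2 3,
    fun L hL v hv ↦ exists_lift_of_exactAt (by lia) (by lia) (htensor L hL 2) v hv⟩

/-- A Gorenstein flat module that is a quotient of a flat module by a flat submodule is flat. -/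
lemma IsGorensteinFlat.isFlat_of_shortExact {S : ShortComplex (ModuleCat.{u} R)}
    (hS : S.ShortExact) (h₁ : IsFlat S.X₁) (h₂ : IsFlat S.X₂) (h₃ : IsGorensteinFlat S.X₃) :
    IsFlat S.X₃ := by
  rw [isFlat_iff_injective_rightDual] at h₁ h₂ ⊢
  obtain ⟨U, V, W, i, q, r, w, hU, hi, hiq, hqr, hlift⟩ := h₃.exists_coresolution
  have := (rightDualFunctor R).preservesFiniteLimits_of_preservesHomology
  have := (rightDualFunctor R).preservesFiniteColimits_of_preservesHomology
  have hS' := hS.op.map_of_exact (rightDualFunctor R)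
  set D := S.op.map (rightDualFunctor R)
  obtain ⟨a, ha⟩ : ∃ a : rightDual S.X₃ ⟶ rightDual S.X₂, a = D.f := ⟨_, rfl⟩
  obtain ⟨b, hb⟩ : ∃ b : rightDual S.X₂ ⟶ rightDual S.X₁, b = D.g := ⟨_, rfl⟩
  have hab : a ≫ b = 0 := by subst ha hb; exact D.zero
  have : Mono a := by subst ha; exact hS'.mono_f
  have : Epi b := by subst hb; exact hS'.epi_g
  have hD : (ShortComplex.mk a b hab).Exact := by subst ha hb; exact hS'.exact
  -- The aim is a retraction of `a : S.X₃⁺ ⟶ S.X₂⁺`. The extension `u` of `i` need not land in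
  -- `S.X₃⁺ = ker q`; its defect `u ≫ q` factors through `S.X₁⁺` as `v`.
  let u := Injective.factorThru i a
  have hu : a ≫ u = i := Injective.comp_factorThru _ _
  let v : rightDual S.X₁ ⟶ V := hD.desc (u ≫ q) (by dsimp; rw [reassoc_of% hu, w])
  have hv : b ≫ v = u ≫ q := hD.g_desc _ _
  -- Gorenstein flatness enters here: as `S.X₁⁺` is injective, `v` lifts along `q`, and subtracting
  -- the lift from `u` removes the defect.
  obtain ⟨l, hl⟩ := hlift _ h₁ v (by
    rw [← cancel_epi b, reassoc_of% hv, hqr, comp_zero, comp_zero])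
  let t : rightDual S.X₂ ⟶ rightDual S.X₃ := hiq.lift (u - b ≫ l) (by
    dsimp
    rw [Preadditive.sub_comp, Category.assoc, hl, hv, sub_self])
  have ht : t ≫ i = u - b ≫ l := hiq.lift_f _ _
  refine Retract.injective ⟨a, t, ?_⟩
  rw [← cancel_mono i, Category.assoc, ht, Preadditive.comp_sub, reassoc_of% hab, zero_comp,
    sub_zero, hu, Category.id_comp]

/-- Vanishing of `H_j(F)` is what makes `C_j → F_i` injective; its image is that of the
differential, so its cokernel is `C_i`. -/
lemma shortExact_opcycles {F : ChainComplex (ModuleCat.{u} R) ℤ} {i j : ℤ} (hij : i + 1 = j)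
    (hj : F.ExactAt j) : (ShortComplex.mk (F.fromOpcycles j i) (F.pOpcycles i) (by
      rw [← cancel_epi (F.pOpcycles j), F.p_fromOpcycles_assoc, F.d_pOpcycles,
        comp_zero])).ShortExact where
  exact := ShortComplex.exact_of_g_is_cokernel _
    (isCokernelOfComp (F.pOpcycles j) (F.d j i) (F.opcyclesIsCokernel j i (by simp [← hij])) _
      (F.p_fromOpcycles j i))
  mono_f := by
    have h : (ComplexShape.down ℤ).next j = i := (ComplexShape.down ℤ).next_eq' hij
    subst h
    exact (F.sc j).exact_iff_mono_fromOpcycles.1 hj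
  epi_g := inferInstance

lemma isFlat_opcycles_of_isGorensteinFlat {F : ChainComplex (ModuleCat.{u} R) ℤ} {i j : ℤ}
    (hij : i + 1 = j) (hj : F.ExactAt j) (hF : IsFlat (F.X i)) (hi : IsGorensteinFlat (F.opcycles i))
    (h : IsFlat (F.opcycles j)) : IsFlat (F.opcycles i) :=
  hi.isFlat_of_shortExact (shortExact_opcycles hij hj) h hF

/-! ### Gorenstein flatness of flat modules -/

lemma acyclic_of_homotopy {C ι : Type*} [Category* C] [Abelian C] {c : ComplexShape ι}
    {K : HomologicalComplex C c} (h : Homotopy (𝟙 K) 0) : K.Acyclic := by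
  intro n
  rw [K.exactAt_iff_isZero_homology, IsZero.iff_id_eq_zero, ← HomologicalComplex.homologyMap_id,
    h.homologyMap_eq, HomologicalComplex.homologyMap_zero]

/-- The components of the contraction of the product of the disk complexes of a module. -/
def diskProductContraction (M : ModuleCat.{u} R) (i j : ℤ) :
    (diskProduct M).X i ⟶ (diskProduct M).X j :=
  ModuleCat.ofHom ((LinearMap.inl R M M).comp (LinearMap.snd R M M))

/-- The product of the disk complexes of a module is contractible. -/
noncomputable def diskProductHomotopy (M : ModuleCat.{u} R) : Homotopy (𝟙 (diskProduct M)) 0 where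
  hom i j := if i + 1 = j then diskProductContraction M i j else 0
  zero i j hij := if_neg hij
  comm n := by
    obtain ⟨m, rfl⟩ : ∃ m, n = m + 1 := ⟨n - 1, by lia⟩
    rw [dNext_eq _ (show (ComplexShape.down ℤ).Rel (m + 1) m from rfl),
      prevD_eq _ (show (ComplexShape.down ℤ).Rel (m + 1 + 1) (m + 1) from rfl), if_pos rfl,
      if_pos rfl, diskProduct_d, diskProduct_d]
    refine ModuleCat.hom_ext (LinearMap.ext fun (x : M × M) ↦ ?_)
    change x = (x.1, (0 : M)) + ((0 : M), x.2) + 0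
    simp

lemma isFlat_prod {M : ModuleCat.{u} R} (hM : IsFlat M) : IsFlat (ModuleCat.of R (M × M)) := by
  rw [isFlat_iff_injective_rightDual] at hM ⊢
  refine ⟨fun {A B} g f _ ↦ ?_⟩
  let i₁ : M ⟶ ModuleCat.of R (M × M) := ModuleCat.ofHom (LinearMap.inl R M M)
  let i₂ : M ⟶ ModuleCat.of R (M × M) := ModuleCat.ofHom (LinearMap.inr R M M)
  refine ⟨Injective.factorThru (g ≫ rightDual.map i₁) f ≫
      rightDual.map (ModuleCat.ofHom (LinearMap.fst R M M)) +
    Injective.factorThru (g ≫ rightDual.map i₂) f ≫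
      rightDual.map (ModuleCat.ofHom (LinearMap.snd R M M)), ?_⟩
  rw [Preadditive.comp_add, Injective.comp_factorThru_assoc, Injective.comp_factorThru_assoc]
  refine ModuleCat.hom_ext (LinearMap.ext fun a ↦ rightDual.ext fun (x : M × M) ↦ ?_)
  refine (map_add (g.hom a) ((x.1, 0) : M × M) ((0, x.2) : M × M)).symm.trans ?_
  exact congrArg (g.hom a) (by simp : ((x.1, 0) : M × M) + (0, x.2) = x)

/-- Flat modules are Gorenstein flat. -/
lemma IsFlat.isGorensteinFlat {M : ModuleCat.{u} R} (hM : IsFlat M) : IsGorensteinFlat M := by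
  -- The terms are `M × M` with `d (a, b) = (0, a)`. Contractibility survives tensoring, and the
  -- cycles `0 × M` are a copy of `M`.
  refine ⟨diskProduct M, acyclic_of_homotopy (diskProductHomotopy M), fun n ↦ isFlat_prod hM,
    fun I _ ↦ ?_, ?_⟩
  · let G := ((tensorBifunctor R).obj I).mapHomologicalComplex (ComplexShape.down ℤ)
    exact acyclic_of_homotopy ((Homotopy.ofEq (G.map_id (diskProduct M)).symm).trans
      ((((tensorBifunctor R).obj I).mapHomotopy (diskProductHomotopy M)).trans
        (Homotopy.ofEq (G.map_zero _ _))))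
  have hd' (j k : ℤ) (h : k + 1 = j) : (diskProduct M).d j k =
      ModuleCat.ofHom ((LinearMap.inr R M M).comp (LinearMap.fst R M M)) := by
    subst h
    exact diskProduct_d M k
  have hd := hd' 0 (-1) rfl
  let i : M ⟶ (diskProduct M).X 0 := ModuleCat.ofHom (LinearMap.inr R M M)
  let f : M ⟶ (diskProduct M).cycles 0 := (diskProduct M).liftCycles i (-1) (by simp) (by
    rw [hd]; rfl)
  have hf : f ≫ (diskProduct M).iCycles 0 = i := (diskProduct M).liftCycles_i _ _ _ _
  have hinj := (ModuleCat.mono_iff_injective ((diskProduct M).iCycles 0)).1 inferInstance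
  have : IsIso f := by
    rw [ConcreteCategory.isIso_iff_bijective]
    refine ⟨fun x y hxy ↦ ?_, fun x ↦ ?_⟩
    · have h := congrArg ((diskProduct M).iCycles 0).hom hxy
      have h' : i.hom x = i.hom y := by
        rw [← hf]
        exact h
      exact congrArg Prod.snd h'
    · obtain ⟨y, hy⟩ : ∃ y : M × M, y = ((diskProduct M).iCycles 0).hom x := ⟨_, rfl⟩
      have h := congr($((diskProduct M).iCycles_d 0 (-1)).hom x)
      rw [hd] at h
      have h₁ : y.1 = 0 := by
        rw [hy]
        exact congrArg Prod.snd h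
      refine ⟨y.2, hinj ?_⟩
      refine congr($(hf).hom y.2).trans (Eq.trans ?_ hy)
      exact Prod.ext h₁.symm rfl
  exact ⟨asIso f⟩

end FiniteFlatDimension

/-! ### Comparison of the two dimensions -/

section Dimensions

variable {R : Type u} [Ring R] {N : ChainComplex (ModuleCat.{u} R) ℤ} {g : ℤ}

lemma supHomologyLE_iff_of_quasiIso {F : ChainComplex (ModuleCat.{u} R) ℤ} (π : F ⟶ N)
    [QuasiIso π] : SupHomologyLE F g ↔ SupHomologyLE N g :=
  forall₂_congr fun j _ ↦ exactAt_iff_of_quasiIsoAt π j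

lemma QuasiIsomorphic.supHomologyLE_iff {F : ChainComplex (ModuleCat.{u} R) ℤ}
    (h : QuasiIsomorphic F N) : SupHomologyLE F g ↔ SupHomologyLE N g := by
  induction h with
  | rel X Y h =>
    obtain ⟨f, hf⟩ := h
    exact supHomologyLE_iff_of_quasiIso f
  | refl X => rfl
  | symm X Y _ h => exact h.symm
  | trans X Y Z _ _ h h' => exact h.trans h'

lemma FdLE.gfdLE (h : FdLE N g) : GfdLE N g := by
  obtain ⟨F, π, hF, hπ⟩ := exists_isDGFlat_resolution N
  exact ⟨F, π, hF, hπ, (supHomologyLE_iff_of_quasiIso π).2 h.1,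
    fun j hj ↦ (h.2 F hF (.rel _ _ ⟨π, hπ⟩) j hj).isGorensteinFlat⟩

/-- Flatness of the cokernels of one resolution descends from `g₀` to `g`, then passes to every
other DG-flat complex. -/
lemma GfdLE.fdLE {g₀ : ℤ} (h : GfdLE N g) (h₀ : FdLE N g₀) : FdLE N g := by
  obtain ⟨F, π, hF, hπ, hsup, hflat⟩ := h
  have hFN : QuasiIsomorphic F N := .rel _ _ ⟨π, hπ⟩
  have key (n : ℕ) : ∀ j, g ≤ j → g₀ ≤ j + n → IsFlat (F.opcycles j) := by
    induction n with
    | zero => exact fun j _ hj ↦ h₀.2 F hF hFN j (by simpa using hj)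
    | succ n ih =>
      intro j hj hj₀
      exact isFlat_opcycles_of_isGorensteinFlat rfl (hsup (j + 1) (by lia)) (hF.1 j) (hflat j hj)
        (ih (j + 1) (by lia) (by lia))
  refine ⟨(supHomologyLE_iff_of_quasiIso π).1 hsup, fun F' hF' hF'N j hj ↦ ?_⟩
  exact hF.isFlat_opcycles hF' (.trans _ _ _ hFN (.symm _ _ hF'N)) rfl (hsup _ (by lia))
    (hF'N.supHomologyLE_iff.2 (hFN.supHomologyLE_iff.1 hsup) _ (by lia))
    -- For `j ≥ g₀` the truncation gives `0` steps, which is still enough.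
    (key (g₀ - j).toNat j hj (by lia))

lemma gfd_le_fd (N : ChainComplex (ModuleCat.{u} R) ℤ) : gfd N ≤ fd N :=
  sInf_le_sInf fun _ ⟨g, hg, hx⟩ ↦ ⟨g, hg.gfdLE, hx⟩

lemma exists_fdLE_of_fd_lt_top (h : fd N < ⊤) : ∃ g, FdLE N g := by
  by_contra! hN
  refine h.ne ?_
  have : {x : WithBot (WithTop ℤ) | ∃ g : ℤ, FdLE N g ∧ x = ((g : WithTop ℤ) : _)} = ∅ :=
    Set.eq_empty_of_forall_notMem fun _ ⟨g, hg, _⟩ ↦ hN g hg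
  rw [fd, infDim, this, sInf_empty]

/-- A single finite bound `g₀` makes the conditions `GfdLE N g` and `FdLE N g` equivalent for every
`g`, so the infima agree, also when they are `-∞`. -/
lemma gfd_eq_fd (h : fd N < ⊤) : gfd N = fd N := by
  obtain ⟨g₀, hg₀⟩ := exists_fdLE_of_fd_lt_top h
  have : GfdLE N = FdLE N := funext fun g ↦ propext ⟨fun hg ↦ hg.fdLE hg₀, FdLE.gfdLE⟩
  rw [gfd, fd, this]

end Dimensions
end GorensteinFlat

theorem proposition1 {R : Type u} [Ring R] (hR : GorensteinFlat.IsLeftGFClosed R)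
    (N : ChainComplex (ModuleCat.{u} R) ℤ) :
    GorensteinFlat.gfd N ≤ GorensteinFlat.fd N ∧
      (GorensteinFlat.fd N < ⊤ → GorensteinFlat.gfd N = GorensteinFlat.fd N) :=
  ⟨GorensteinFlat.gfd_le_fd N, GorensteinFlat.gfd_eq_fd⟩
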